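/- Let $K \ge 0$ and $\epsilon > 0$. There exists a constant $C = C(K,\epsilon) > 0$ such that the following holds for every integer $m \ge 2$ and every smooth, connected Riemannian manifold $(M,g)$ of dimension $m$ without boundary (not necessarily complete) whose Ricci curvature satisfies $\operatorname{Ric} \ge -K^2$, i.e. $\operatorname{Ric}(X,X) \ge -K^2\, g(X,X)$ for every tangent vector $X$. For every $u \in C^\infty_c(M)$, $$\|u\|_{W^{2,2}} := \|u\|_{L^2} + \|\nabla u\|_{L^2} + \|\operatorname{Hess}(u)\|_{L^2} \le C\left\{ \|u\|_{L^2} + \|\Delta u\|_{L^2} \right\}.$$ Here $\operatorname{Hess}(u) = D\,du$ with $D$ the Levi-Civita connection, $\Delta u = \operatorname{trace}_g \operatorname{Hess}(u)$ is the Laplace–Beltrami operator, lengths of tensors are taken with respect to $g$, and the $L^2$-norms are taken over $M$ with respect to the Riemannian measure $\mathrm{dvol} = \sqrt{\det[g_{ij}]}\,dx^1\cdots dx^m$. -/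

import Mathlib

open MeasureTheory Manifold
open scoped ContDiff ENNReal

noncomputable section

namespace RiemL2

/-- The Euclidean space in which coordinates take their values. -/
abbrev Coord (m : ℕ) : Type := EuclideanSpace ℝ (Fin m)

/-! ### Tensor calculus in one coordinate system

Below `G y = (g_ij(y))` is the matrix of metric coefficients in a coordinate system, as a function
of the coordinates `y`, and `f` is a function of the coordinates. -/

section Coordinates

variable {m : ℕ}

/-- The partial derivative `∂_i f` at `y`. -/
def pd (i : Fin m) (f : Coord m → ℝ) (y : Coord m) : ℝ :=
  fderiv ℝ f y (EuclideanSpace.single i 1)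

/-- The inverse metric coefficient `g^ij`. -/
def invMetric (G : Coord m → Matrix (Fin m) (Fin m) ℝ) (i j : Fin m) (y : Coord m) : ℝ :=
  (G y)⁻¹ i j

/-- The Christoffel symbols of the Levi-Civita connection, `D_{∂_i} ∂_j = ∑ k, Γ^k_ij ∂_k`:
`Γ^k_ij = 1/2 ∑ l, g^kl (∂_i g_jl + ∂_j g_il - ∂_l g_ij)`. -/
def christoffel (G : Coord m → Matrix (Fin m) (Fin m) ℝ) (k i j : Fin m) (y : Coord m) : ℝ :=
  (1 / 2) * ∑ l, invMetric G k l y *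
    (pd i (fun z => G z j l) y + pd j (fun z => G z i l) y - pd l (fun z => G z i j) y)

/-- The components of the Riemann curvature,
`D_{∂_i} D_{∂_j} ∂_k - D_{∂_j} D_{∂_i} ∂_k = ∑ l, R^l_kij ∂_l`
(the bracket of coordinate fields vanishes). -/
def riemann (G : Coord m → Matrix (Fin m) (Fin m) ℝ) (l k i j : Fin m) (y : Coord m) : ℝ :=
  pd i (christoffel G l j k) y - pd j (christoffel G l i k) y
    + ∑ s, (christoffel G l i s y * christoffel G s j k y
      - christoffel G l j s y * christoffel G s i k y)

/-- The components `Ric_jk` of the Ricci curvature `Ric(X, Y) = trace (Z ↦ R(Z, X) Y)`.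
With this sign the unit sphere of dimension `m` has `Ric = (m - 1) g`. -/
def ricci (G : Coord m → Matrix (Fin m) (Fin m) ℝ) (j k : Fin m) (y : Coord m) : ℝ :=
  ∑ i, riemann G i k i j y

/-- The components of the Hessian `Hess f = D df`:
`Hess_ij f = ∂_i ∂_j f - ∑ k, Γ^k_ij ∂_k f`. -/
def hess (G : Coord m → Matrix (Fin m) (Fin m) ℝ) (f : Coord m → ℝ) (i j : Fin m)
    (y : Coord m) : ℝ :=
  pd i (pd j f) y - ∑ k, christoffel G k i j y * pd k f y

/-- The Laplace-Beltrami operator `Δ f = trace_g (Hess f) = ∑ i j, g^ij Hess_ij f`. -/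
def laplace (G : Coord m → Matrix (Fin m) (Fin m) ℝ) (f : Coord m → ℝ) (y : Coord m) : ℝ :=
  ∑ i, ∑ j, invMetric G i j y * hess G f i j y

/-- The squared length of the gradient, `|∇ f|² = ∑ i j, g^ij ∂_i f ∂_j f`. -/
def gradSq (G : Coord m → Matrix (Fin m) (Fin m) ℝ) (f : Coord m → ℝ) (y : Coord m) : ℝ :=
  ∑ i, ∑ j, invMetric G i j y * pd i f y * pd j f y

/-- The squared length of the Hessian,
`|Hess f|² = ∑ i j k l, g^ik g^jl Hess_ij f Hess_kl f`. -/
def hessSq (G : Coord m → Matrix (Fin m) (Fin m) ℝ) (f : Coord m → ℝ) (y : Coord m) : ℝ :=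
  ∑ i, ∑ j, ∑ k, ∑ l,
    invMetric G i k y * invMetric G j l y * hess G f i j y * hess G f k l y

end Coordinates

/-! ### Riemannian manifolds -/

section Manifold

variable {m : ℕ} {M : Type*} [TopologicalSpace M] [ChartedSpace (Coord m) M]
  [IsManifold (𝓡 m) ∞ M]

/-- Smooth Riemannian metrics on a smooth `m`-dimensional manifold without boundary. -/
abbrev Metric (m : ℕ) (M : Type*) [TopologicalSpace M] [ChartedSpace (Coord m) M]
    [IsManifold (𝓡 m) ∞ M] : Type _ :=
  Bundle.ContMDiffRiemannianMetric (𝓡 m) ∞ (Coord m) (fun x : M => TangentSpace (𝓡 m) x)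

/-- The coordinate vector field `∂_i` of the chart `e`, at the point with coordinates `y`. -/
def coordVec (e : OpenPartialHomeomorph M (Coord m)) (i : Fin m) (y : Coord m) :
    TangentSpace (𝓡 m) (e.symm y) :=
  mfderiv (𝓡 m) (𝓡 m) e.symm y (EuclideanSpace.single i (1 : ℝ) : Coord m)

/-- The metric coefficients `g_ij = g(∂_i, ∂_j)` in the chart `e`. They are meaningful on
`e.target`. -/
def gram (g : Metric m M) (e : OpenPartialHomeomorph M (Coord m)) (y : Coord m) :
    Matrix (Fin m) (Fin m) ℝ :=
  Matrix.of fun i j => g.inner (e.symm y) (coordVec e i y) (coordVec e j y)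

/-- `Ric ≥ c` in the sense of quadratic forms, `Ric(X, X) ≥ c |X|²` for every tangent vector
`X = ∑ i, ξ i ∂_i`. -/
def RicciBoundedBelow (g : Metric m M) (c : ℝ) : Prop :=
  ∀ e ∈ atlas (Coord m) M, ∀ x ∈ e.source, ∀ ξ : Fin m → ℝ,
    c * ∑ i, ∑ j, gram g e (e x) i j * ξ i * ξ j
      ≤ ∑ i, ∑ j, ricci (gram g e) i j (e x) * ξ i * ξ j

/-- The Laplace-Beltrami operator on `M`. Its value at `x` does not depend on the chart at `x`
in which it is computed; here this is the preferred chart at `x`. The same holds for the next two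
definitions. -/
def laplacian (g : Metric m M) (u : M → ℝ) (x : M) : ℝ :=
  laplace (gram g (chartAt (Coord m) x)) (u ∘ (chartAt (Coord m) x).symm)
    (chartAt (Coord m) x x)

/-- The pointwise length `|∇ u|` of the gradient. -/
def gradNorm (g : Metric m M) (u : M → ℝ) (x : M) : ℝ :=
  √(gradSq (gram g (chartAt (Coord m) x)) (u ∘ (chartAt (Coord m) x).symm)
    (chartAt (Coord m) x x))

/-- The pointwise length `|Hess u|` of the Hessian. -/
def hessNorm (g : Metric m M) (u : M → ℝ) (x : M) : ℝ :=
  √(hessSq (gram g (chartAt (Coord m) x)) (u ∘ (chartAt (Coord m) x).symm)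
    (chartAt (Coord m) x x))

/-- The measure `√(det g_ij) dx¹ ⋯ dxᵐ` on the domain of the chart `e`, as a measure on `M`. -/
def chartMeasure [MeasurableSpace M] (g : Metric m M)
    (e : OpenPartialHomeomorph M (Coord m)) : Measure M :=
  Measure.map e.symm
    ((volume.restrict e.target).withDensity fun y => ENNReal.ofReal √(gram g e y).det)

/-- Countably many charts cover a second countable manifold. -/
theorem exists_chart_cover (m : ℕ) (M : Type*) [TopologicalSpace M] [ChartedSpace (Coord m) M]
    [SecondCountableTopology M] [Nonempty M] :
    ∃ c : ℕ → M, ⋃ n, (chartAt (Coord m) (c n)).source = Set.univ := by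
  obtain ⟨s, hs, hU⟩ := TopologicalSpace.countable_cover_nhds
    (fun x : M => chart_source_mem_nhds (Coord m) x)
  have hne : s.Nonempty := by
    rcases s.eq_empty_or_nonempty with h | h
    · subst h
      simp only [Set.mem_empty_iff_false, Set.iUnion_of_empty, Set.iUnion_empty] at hU
      exact absurd hU.symm Set.univ_nonempty.ne_empty
    · exact h
  obtain ⟨c, rfl⟩ := hs.exists_eq_range hne
  exact ⟨c, by simpa using hU⟩

/-- The centres of countably many charts that cover `M`. -/
def chartCenter (m : ℕ) (M : Type*) [TopologicalSpace M] [ChartedSpace (Coord m) M]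
    [SecondCountableTopology M] [Nonempty M] : ℕ → M :=
  (exists_chart_cover m M).choose

/-- The Riemannian measure `dvol`: cut `M` into countably many disjoint Borel pieces, each in the
domain of one chart, and add up the measures `√(det g_ij) dx¹ ⋯ dxᵐ` of the pieces. By the change
of variables formula the result does not depend on the choice of charts, and it agrees with
`√(det g_ij) dx¹ ⋯ dxᵐ` in each chart. -/
def riemannianMeasure [SecondCountableTopology M] [Nonempty M] [MeasurableSpace M]
    (g : Metric m M) : Measure M :=
  Measure.sum fun n : ℕ =>
    (chartMeasure g (chartAt (Coord m) (chartCenter m M n))).restrict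
      (disjointed (fun k => (chartAt (Coord m) (chartCenter m M k)).source) n)

end Manifold

end RiemL2

end

/-!
The estimate is the integrated Bochner formula. For `u` smooth with compact support,

* `∫ |∇ u|² = - ∫ u Δ u` (`integral_gradInner_self`), hence `∫ |∇ u|² ≤ ∫ u² + ∫ (Δ u)²`;
* `∫ |Hess u|² + ∫ Ric(∇ u, ∇ u) = ∫ (Δ u)²`, so that `Ric ≥ -K²` gives
  `∫ |Hess u|² ≤ ∫ (Δ u)² + K² ∫ |∇ u|²` (`integral_bochner`).

Taking square roots, the constant `3 + K` works in every dimension (`sobolev_estimate`). No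
completeness is needed, since `u` has compact support.

Both formulas come from the divergence theorem, applied to `u ∇ u` and to `D_X X - (div X) X` with
`X = ∇ u`. The divergence of the latter is `tr (D X)² - (div X)² + Ric(X, X)` for every
torsion-free connection (`sum_pd_bochnerField`), a computation with Christoffel symbols in which
the metric does not appear. The metric enters through `MetricAt.covDeriv_grad`, by which `D X` is
the Hessian with an index raised, and `MetricAt.pd_sqrt_det`, by which `∑ s, Γ^s_si` is the
logarithmic derivative of the volume density.

To globalize, the fields are multiplied by functions `φ` that are supported in the domain of a
chart and add up to `1` near the support of `u`. In the sum the terms with derivatives of `φ`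
cancel, because they involve only `⟨∇ φ, ∇ u⟩` and
`⟨∇ φ, D_X X⟩ = Hess u (∇ φ, ∇ u) = 1/2 ⟨∇ φ, ∇ |∇ u|²⟩`, which are linear in `φ` and do not depend
on the chart. The curvature is only ever evaluated in the chart that carries `φ`, so its invariance
is not needed. The invariance of the Hessian follows from that of inner products of gradients by
`2 Hess f (∇ a, ∇ b) = ⟨∇ a, ∇ ⟨∇ f, ∇ b⟩⟩ + ⟨∇ b, ∇ ⟨∇ f, ∇ a⟩⟩ - ⟨∇ f, ∇ ⟨∇ a, ∇ b⟩⟩`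
(`MetricAt.sum_hess_mul_grad`, `CoordChange.hessMatrix_eq`), without second derivatives of the
change of coordinates. The invariance of the measure is the change of variables formula
(`chartMeasure_eq`).
-/

noncomputable section

namespace RiemL2

open Filter Topology

/-! ### Partial derivatives -/

section PartialDerivatives

variable {m : ℕ} {f h : Coord m → ℝ} {y : Coord m}

theorem _root_.ContDiffAt.pd (hf : ContDiffAt ℝ ∞ f y) (i : Fin m) :
    ContDiffAt ℝ ∞ (pd i f) y := by
  have h1 : ContDiffAt ℝ ∞ (fderiv ℝ f) y := hf.fderiv_right (by simp)
  exact h1.clm_apply contDiffAt_const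

theorem _root_.ContDiffAt.differentiableAt_top (hf : ContDiffAt ℝ ∞ f y) :
    DifferentiableAt ℝ f y :=
  hf.differentiableAt (by simp)

theorem _root_.Filter.EventuallyEq.pd (hfh : f =ᶠ[𝓝 y] h) (i : Fin m) :
    pd i f =ᶠ[𝓝 y] pd i h := by
  filter_upwards [hfh.fderiv (𝕜 := ℝ)] with z hz
  simp only [RiemL2.pd, hz]

theorem pd_const (c : ℝ) (i : Fin m) : pd i (fun _ => c) y = 0 := by
  simp [pd]

theorem pd_add (hf : DifferentiableAt ℝ f y) (hh : DifferentiableAt ℝ h y) (i : Fin m) :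
    pd i (fun z => f z + h z) y = pd i f y + pd i h y := by
  simp [pd, fderiv_fun_add hf hh]

theorem pd_sub (hf : DifferentiableAt ℝ f y) (hh : DifferentiableAt ℝ h y) (i : Fin m) :
    pd i (fun z => f z - h z) y = pd i f y - pd i h y := by
  simp [pd, fderiv_fun_sub hf hh]

theorem pd_mul (hf : DifferentiableAt ℝ f y) (hh : DifferentiableAt ℝ h y) (i : Fin m) :
    pd i (fun z => f z * h z) y = pd i f y * h y + f y * pd i h y := by
  simp only [pd, fderiv_fun_mul hf hh, add_apply,
    smul_apply, smul_eq_mul]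
  ring

theorem pd_sum {ι : Type*} (s : Finset ι) {F : ι → Coord m → ℝ}
    (hF : ∀ a ∈ s, DifferentiableAt ℝ (F a) y) (i : Fin m) :
    pd i (fun z => ∑ a ∈ s, F a z) y = ∑ a ∈ s, pd i (F a) y := by
  simp [pd, fderiv_fun_sum hF]

/-- Mixed second partial derivatives commute. -/
theorem pd_comm (hf : ContDiffAt ℝ ∞ f y) (i j : Fin m) :
    pd i (pd j f) y = pd j (pd i f) y := by
  have hd : DifferentiableAt ℝ (fderiv ℝ f) y :=
    (hf.fderiv_right (m := ∞) (by simp)).differentiableAt (by simp)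
  have hsymm : IsSymmSndFDerivAt ℝ f y := hf.isSymmSndFDerivAt
    (by simpa using WithTop.coe_le_coe.2 (le_top : (2 : ℕ∞) ≤ ⊤))
  have key : ∀ a b : Fin m, pd a (pd b f) y
      = fderiv ℝ (fderiv ℝ f) y (EuclideanSpace.single a 1) (EuclideanSpace.single b 1) := by
    intro a b
    change fderiv ℝ (fun z => fderiv ℝ f z (EuclideanSpace.single b 1)) y _ = _
    rw [fderiv_clm_apply hd (differentiableAt_const _)]
    simp
  rw [key, key, hsymm.eq]

end PartialDerivatives

/-! ### The divergence of a covariant derivative -/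

section Affine

variable {m : ℕ}

/-- The covariant derivative `D_{∂_i} X = ∑ k, (∂_i X^k + ∑ s, Γ^k_is X^s) ∂_k` of a vector field
with components `X k`, for a connection with Christoffel symbols `Γ k i j`. -/
def covDeriv (Γ : Fin m → Fin m → Fin m → Coord m → ℝ) (X : Fin m → Coord m → ℝ) (k i : Fin m)
    (y : Coord m) : ℝ :=
  pd i (X k) y + ∑ s, Γ k i s y * X s y

/-- The vector field `D_X X - (div X) X`. -/
def bochnerField (Γ : Fin m → Fin m → Fin m → Coord m → ℝ) (X : Fin m → Coord m → ℝ) (i : Fin m)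
    (y : Coord m) : ℝ :=
  ∑ k, covDeriv Γ X i k y * X k y - (∑ k, covDeriv Γ X k k y) * X i y

/-- The index computation behind `sum_pd_bochnerField`. Here `S k i`, `D i j k`, `dΓ a l i j`
stand for `D_i X^k`, `∂_i ∂_j X^k` and `∂_a Γ^l_ij`. -/
theorem affine_bochner_algebra (X : Fin m → ℝ) (S : Fin m → Fin m → ℝ)
    (Γ D : Fin m → Fin m → Fin m → ℝ) (dΓ : Fin m → Fin m → Fin m → Fin m → ℝ)
    (hΓ : ∀ k i j, Γ k i j = Γ k j i) (hD : ∀ i j k, D i j k = D j i k) :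
    ∑ i, ((∑ k, ((D i k i + ∑ s, (dΓ i i k s * X s + Γ i k s * (S s i - ∑ t, Γ s i t * X t))) * X k
          + S i k * (S k i - ∑ t, Γ k i t * X t)))
        - ((∑ k, (D i k k + ∑ s, (dΓ i k k s * X s + Γ k k s * (S s i - ∑ t, Γ s i t * X t)))) * X i
          + (∑ k, S k k) * (S i i - ∑ t, Γ i i t * X t))
        + (∑ s, Γ s s i) * (∑ k, S i k * X k - (∑ k, S k k) * X i))
      = ∑ i, ∑ k, S i k * S k i - (∑ k, S k k) ^ 2
        + ∑ j, ∑ k, (∑ i, (dΓ i i j k - dΓ j i i k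
          + ∑ s, (Γ i i s * Γ s j k - Γ i j s * Γ s i k))) * X j * X k := by
  -- `e1`, ..., `e8` rename summation indices: they match the terms in which both sides expand
  have e1 : ∑ i, ∑ k, D i k i * X k = ∑ i, ∑ k, D i k k * X i := by
    rw [Finset.sum_comm]
    exact Finset.sum_congr rfl fun a _ => Finset.sum_congr rfl fun b _ => by rw [hD]
  have e2 : ∑ i, ∑ k, ∑ s, dΓ i i k s * X s * X k = ∑ j, ∑ k, ∑ i, dΓ i i j k * X j * X k := by
    rw [Finset.sum_comm]
    refine Finset.sum_congr rfl fun a _ => ?_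
    rw [Finset.sum_comm]
    exact Finset.sum_congr rfl fun b _ => Finset.sum_congr rfl fun c _ => by ring
  have e3 : ∑ i, ∑ k, ∑ s, Γ i k s * S s i * X k = ∑ i, ∑ k, ∑ t, S i k * (Γ k i t * X t) := by
    trans ∑ i, ∑ s, ∑ k, Γ i k s * S s i * X k
    · exact Finset.sum_congr rfl fun a _ => Finset.sum_comm
    rw [Finset.sum_comm]
    exact Finset.sum_congr rfl fun a _ => Finset.sum_congr rfl fun b _ =>
      Finset.sum_congr rfl fun c _ => by rw [hΓ]; ring
  have e4 : ∑ i, ∑ k, ∑ s, ∑ t, Γ i k s * (Γ s i t * X t) * X k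
      = ∑ j, ∑ k, ∑ i, ∑ s, Γ i j s * Γ s i k * X j * X k := by
    rw [Finset.sum_comm]
    refine Finset.sum_congr rfl fun j _ => ?_
    trans ∑ i, ∑ t, ∑ s, Γ i j s * (Γ s i t * X t) * X j
    · exact Finset.sum_congr rfl fun a _ => Finset.sum_comm
    rw [Finset.sum_comm]
    exact Finset.sum_congr rfl fun a _ => Finset.sum_congr rfl fun b _ =>
      Finset.sum_congr rfl fun c _ => by ring
  have e5 : ∑ i, ∑ k, ∑ s, dΓ i k k s * X s * X i = ∑ j, ∑ k, ∑ i, dΓ j i i k * X j * X k := by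
    refine Finset.sum_congr rfl fun j _ => ?_
    rw [Finset.sum_comm]
    exact Finset.sum_congr rfl fun b _ => Finset.sum_congr rfl fun c _ => by ring
  have e6 : ∑ i, ∑ k, ∑ s, Γ k k s * S s i * X i = ∑ i, ∑ s, ∑ k, Γ s s i * (S i k * X k) := by
    trans ∑ i, ∑ s, ∑ k, Γ k k s * S s i * X i
    · exact Finset.sum_congr rfl fun a _ => Finset.sum_comm
    rw [Finset.sum_comm]
    refine Finset.sum_congr rfl fun a _ => ?_
    rw [Finset.sum_comm]
    exact Finset.sum_congr rfl fun b _ => Finset.sum_congr rfl fun c _ => by ring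
  have e7 : ∑ i, ∑ k, ∑ s, ∑ t, Γ k k s * (Γ s i t * X t) * X i
      = ∑ j, ∑ k, ∑ i, ∑ s, Γ i i s * Γ s j k * X j * X k := by
    refine Finset.sum_congr rfl fun j _ => ?_
    trans ∑ i, ∑ t, ∑ s, Γ i i s * (Γ s j t * X t) * X j
    · exact Finset.sum_congr rfl fun a _ => Finset.sum_comm
    rw [Finset.sum_comm]
    exact Finset.sum_congr rfl fun a _ => Finset.sum_congr rfl fun b _ =>
      Finset.sum_congr rfl fun c _ => by ring
  have e8 : (∑ k, S k k) * ∑ i, ∑ t, Γ i i t * X t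
      = ∑ i, (∑ s, Γ s s i) * ((∑ k, S k k) * X i) := by
    rw [Finset.sum_comm, Finset.mul_sum]
    refine Finset.sum_congr rfl fun a _ => ?_
    rw [← Finset.sum_mul]
    ring
  have L : ∑ i, ((∑ k, ((D i k i + ∑ s, (dΓ i i k s * X s + Γ i k s * (S s i - ∑ t, Γ s i t * X t)))
          * X k + S i k * (S k i - ∑ t, Γ k i t * X t)))
        - ((∑ k, (D i k k + ∑ s, (dΓ i k k s * X s + Γ k k s * (S s i - ∑ t, Γ s i t * X t)))) * X i
          + (∑ k, S k k) * (S i i - ∑ t, Γ i i t * X t))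
        + (∑ s, Γ s s i) * (∑ k, S i k * X k - (∑ k, S k k) * X i))
      = ∑ i, ∑ k, D i k i * X k + ∑ i, ∑ k, ∑ s, dΓ i i k s * X s * X k
        + ∑ i, ∑ k, ∑ s, Γ i k s * S s i * X k
        - ∑ i, ∑ k, ∑ s, ∑ t, Γ i k s * (Γ s i t * X t) * X k
        + ∑ i, ∑ k, S i k * S k i - ∑ i, ∑ k, ∑ t, S i k * (Γ k i t * X t)
        - ∑ i, ∑ k, D i k k * X i - ∑ i, ∑ k, ∑ s, dΓ i k k s * X s * X i
        - ∑ i, ∑ k, ∑ s, Γ k k s * S s i * X i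
        + ∑ i, ∑ k, ∑ s, ∑ t, Γ k k s * (Γ s i t * X t) * X i
        - (∑ k, S k k) * ∑ i, S i i + (∑ k, S k k) * ∑ i, ∑ t, Γ i i t * X t
        + ∑ i, ∑ s, ∑ k, Γ s s i * (S i k * X k) - ∑ i, (∑ s, Γ s s i) * ((∑ k, S k k) * X i) := by
    rw [Finset.mul_sum (a := ∑ k, S k k), Finset.mul_sum (a := ∑ k, S k k)]
    simp only [← Finset.sum_add_distrib, ← Finset.sum_sub_distrib]
    refine Finset.sum_congr rfl fun i _ => ?_
    have a1 : (∑ s, Γ s s i) * (∑ k, S i k * X k) = ∑ s, ∑ k, Γ s s i * (S i k * X k) := by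
      rw [Finset.sum_mul_sum]
    rw [mul_sub (∑ s, Γ s s i), a1]
    generalize ∑ k, S k k = c
    generalize ∑ s, Γ s s i = d
    simp only [add_mul, mul_sub, sub_mul, Finset.sum_add_distrib, Finset.sum_sub_distrib,
      Finset.mul_sum, Finset.sum_mul]
    ring
  have R : ∑ j, ∑ k, (∑ i, (dΓ i i j k - dΓ j i i k
          + ∑ s, (Γ i i s * Γ s j k - Γ i j s * Γ s i k))) * X j * X k
      = ∑ j, ∑ k, ∑ i, dΓ i i j k * X j * X k - ∑ j, ∑ k, ∑ i, dΓ j i i k * X j * X k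
        + ∑ j, ∑ k, ∑ i, ∑ s, Γ i i s * Γ s j k * X j * X k
        - ∑ j, ∑ k, ∑ i, ∑ s, Γ i j s * Γ s i k * X j * X k := by
    simp only [← Finset.sum_add_distrib, ← Finset.sum_sub_distrib, Finset.sum_mul]
    refine Finset.sum_congr rfl fun j _ => Finset.sum_congr rfl fun k _ =>
      Finset.sum_congr rfl fun i _ => ?_
    simp only [add_mul, sub_mul, Finset.sum_sub_distrib, Finset.sum_mul]
    ring
  rw [L, R, e1, e2, e3, e4, e5, e6, e7, e8]
  ring

/-- The divergence, with respect to a torsion-free connection, of `D_X X - (div X) X` is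
`tr (D X)² - (div X)² + Ric(X, X)`. The metric plays no role in this identity. -/
theorem sum_pd_bochnerField {Γ : Fin m → Fin m → Fin m → Coord m → ℝ} {X : Fin m → Coord m → ℝ}
    {y : Coord m} (hΓ : ∀ k i j, ContDiffAt ℝ ∞ (Γ k i j) y) (hX : ∀ k, ContDiffAt ℝ ∞ (X k) y)
    (hsymm : ∀ k i j, Γ k i j y = Γ k j i y) :
    ∑ i, (pd i (bochnerField Γ X i) y + (∑ s, Γ s s i y) * bochnerField Γ X i y)
      = ∑ i, ∑ k, covDeriv Γ X i k y * covDeriv Γ X k i y - (∑ k, covDeriv Γ X k k y) ^ 2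
        + ∑ j, ∑ k, (∑ i, (pd i (Γ i j k) y - pd j (Γ i i k) y
          + ∑ s, (Γ i i s y * Γ s j k y - Γ i j s y * Γ s i k y))) * X j y * X k y := by
  have dΓ : ∀ k i j, DifferentiableAt ℝ (Γ k i j) y := fun k i j => (hΓ k i j).differentiableAt_top
  have dX : ∀ k, DifferentiableAt ℝ (X k) y := fun k => (hX k).differentiableAt_top
  have hS : ∀ k i, ContDiffAt ℝ ∞ (covDeriv Γ X k i) y := fun k i =>
    ((hX k).pd i).add (ContDiffAt.sum fun s _ => (hΓ k i s).mul (hX s))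
  have dS : ∀ k i, DifferentiableAt ℝ (covDeriv Γ X k i) y :=
    fun k i => (hS k i).differentiableAt_top
  have pX : ∀ k i, pd i (X k) y = covDeriv Γ X k i y - ∑ s, Γ k i s y * X s y := by
    intro k i; simp [covDeriv]
  have pS : ∀ a k i, pd a (covDeriv Γ X k i) y = pd a (pd i (X k)) y
      + ∑ s, (pd a (Γ k i s) y * X s y + Γ k i s y
        * (covDeriv Γ X s a y - ∑ t, Γ s a t y * X t y)) := by
    intro a k i
    have h1 : ∀ s ∈ Finset.univ, DifferentiableAt ℝ (fun z => Γ k i s z * X s z) y :=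
      fun s _ => (dΓ k i s).mul (dX s)
    have h2 := pd_add ((hX k).pd i).differentiableAt_top (DifferentiableAt.fun_sum h1) a
    rw [pd_sum _ h1] at h2
    refine h2.trans (congrArg _ (Finset.sum_congr rfl fun s _ => ?_))
    rw [pd_mul (dΓ k i s) (dX s), pX s a]
  have pW : ∀ i, pd i (bochnerField Γ X i) y
      = (∑ k, (pd i (covDeriv Γ X i k) y * X k y + covDeriv Γ X i k y * pd i (X k) y))
        - ((∑ k, pd i (covDeriv Γ X k k) y) * X i y
          + (∑ k, covDeriv Γ X k k y) * pd i (X i) y) := by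
    intro i
    have h1 : ∀ k ∈ Finset.univ, DifferentiableAt ℝ (fun z => covDeriv Γ X i k z * X k z) y :=
      fun k _ => (dS i k).mul (dX k)
    have h3 : ∀ k ∈ Finset.univ, DifferentiableAt ℝ (covDeriv Γ X k k) y := fun k _ => dS k k
    have h2 := pd_sub (DifferentiableAt.fun_sum h1) ((DifferentiableAt.fun_sum h3).fun_mul (dX i)) i
    refine h2.trans ?_
    rw [pd_sum _ h1, pd_mul (DifferentiableAt.fun_sum h3) (dX i), pd_sum _ h3]
    simp only [pd_mul (dS _ _) (dX _)]
  have key := affine_bochner_algebra (fun k => X k y) (fun k i => covDeriv Γ X k i y)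
    (fun k i j => Γ k i j y) (fun i j k => pd i (pd j (X k)) y)
    (fun a l i j => pd a (Γ l i j) y) hsymm (fun i j k => pd_comm (hX k) i j)
  rw [← key]
  refine Finset.sum_congr rfl fun i _ => ?_
  rw [pW]
  simp only [pS, pX, bochnerField]

end Affine

/-! ### Metric coefficients near a point -/

section MetricAt

variable {m : ℕ}

/-- `G` is, near `y`, the coefficient matrix of a Riemannian metric that is smooth at `y`. -/
structure MetricAt (G : Coord m → Matrix (Fin m) (Fin m) ℝ) (y : Coord m) : Prop where
  smooth : ∀ i j, ContDiffAt ℝ ∞ (fun z => G z i j) y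
  posDef : ∀ᶠ z in 𝓝 y, (G z).PosDef

theorem contDiffAt_det {n : ℕ∞ω} {A : Coord m → Matrix (Fin m) (Fin m) ℝ} {y : Coord m}
    (hA : ∀ i j, ContDiffAt ℝ n (fun z => A z i j) y) : ContDiffAt ℝ n (fun z => (A z).det) y := by
  simp only [Matrix.det_apply']
  exact ContDiffAt.sum fun σ _ => contDiffAt_const.mul (contDiffAt_prod fun i _ => hA _ _)

/-- **Jacobi's formula** for the derivative of a determinant. -/
theorem pd_det {A : Coord m → Matrix (Fin m) (Fin m) ℝ} {y : Coord m}
    (hA : ∀ i j, DifferentiableAt ℝ (fun z => A z i j) y) (a : Fin m) :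
    pd a (fun z => (A z).det) y
      = ∑ i, ∑ j, (A y).adjugate i j * pd a (fun z => A z j i) y := by
  have h1 : HasFDerivAt (fun z => (A z).det) (∑ σ : Equiv.Perm (Fin m),
      ((Equiv.Perm.sign σ : ℤ) : ℝ) • ∑ i, (∏ j ∈ Finset.univ.erase i, A y (σ j) j) •
        fderiv ℝ (fun z => A z (σ i) i) y) y := by
    simp only [Matrix.det_apply']
    refine HasFDerivAt.fun_sum fun σ _ => HasFDerivAt.const_mul ?_ _
    exact HasFDerivAt.finsetProd fun i _ => (hA (σ i) i).hasFDerivAt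
  have h2 : ∀ i, ∑ j, (A y).adjugate i j * pd a (fun z => A z j i) y
      = ((A y).updateCol i (fun j => pd a (fun z => A z j i) y)).det := by
    intro i
    rw [← Matrix.cramer_apply, Matrix.cramer_eq_adjugate_mulVec]
    rfl
  rw [pd, h1.fderiv]
  simp only [h2, Matrix.det_apply']
  rw [Finset.sum_comm]
  simp only [sum_apply, smul_apply, smul_eq_mul, Finset.mul_sum]
  refine Finset.sum_congr rfl fun σ _ => Finset.sum_congr rfl fun i _ => ?_
  rw [← Finset.mul_prod_erase _ _ (Finset.mem_univ i)]
  have h3 : ∏ j ∈ Finset.univ.erase i,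
      (A y).updateCol i (fun j => pd a (fun z => A z j i) y) (σ j) j
      = ∏ j ∈ Finset.univ.erase i, A y (σ j) j :=
    Finset.prod_congr rfl fun j hj => by
      rw [Matrix.updateCol_ne (Finset.ne_of_mem_erase hj)]
  rw [h3, Matrix.updateCol_self, pd]
  ring

namespace MetricAt

variable {G : Coord m → Matrix (Fin m) (Fin m) ℝ} {y : Coord m}

theorem differentiableAt (hG : MetricAt G y) (i j : Fin m) :
    DifferentiableAt ℝ (fun z => G z i j) y :=
  (hG.smooth i j).differentiableAt_top

theorem symm_eventually (hG : MetricAt G y) (i j : Fin m) :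
    (fun z => G z i j) =ᶠ[𝓝 y] fun z => G z j i := by
  filter_upwards [hG.posDef] with z hz
  simpa using hz.1.apply j i

theorem symm (hG : MetricAt G y) (i j : Fin m) : G y i j = G y j i :=
  (hG.symm_eventually i j).self_of_nhds

theorem pd_symm (hG : MetricAt G y) (a i j : Fin m) :
    pd a (fun z => G z i j) y = pd a (fun z => G z j i) y :=
  ((hG.symm_eventually i j).pd a).self_of_nhds

theorem det_pos (hG : MetricAt G y) : 0 < (G y).det := hG.posDef.self_of_nhds.det_pos

theorem inv_mul (hG : MetricAt G y) : (G y)⁻¹ * G y = 1 :=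
  Matrix.nonsing_inv_mul _ hG.det_pos.ne'.isUnit

theorem mul_inv (hG : MetricAt G y) : G y * (G y)⁻¹ = 1 :=
  Matrix.mul_nonsing_inv _ hG.det_pos.ne'.isUnit

theorem invMetric_symm (hG : MetricAt G y) (i j : Fin m) :
    invMetric G i j y = invMetric G j i y := by
  have h := hG.posDef.self_of_nhds.inv.1.apply j i
  rwa [star_trivial] at h

theorem contDiffAt_invMetric (hG : MetricAt G y) (i j : Fin m) :
    ContDiffAt ℝ ∞ (invMetric G i j) y := by
  have h : invMetric G i j = fun z => ((G z).det)⁻¹ * (G z).adjugate i j := by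
    funext z
    simp [invMetric, Matrix.inv_def]
  rw [h]
  refine ((contDiffAt_det hG.smooth).inv hG.det_pos.ne').mul ?_
  simp only [Matrix.adjugate_apply]
  refine contDiffAt_det fun k l => ?_
  by_cases hk : k = j
  · subst hk
    simp only [Matrix.updateRow_self]
    exact contDiffAt_const
  · simp only [Matrix.updateRow_ne hk]
    exact hG.smooth k l

theorem pd_invMetric (hG : MetricAt G y) (a k l : Fin m) :
    pd a (invMetric G k l) y
      = - ∑ q, ∑ r, invMetric G k q y * pd a (fun z => G z q r) y * invMetric G r l y := by
  set D : Matrix (Fin m) (Fin m) ℝ := Matrix.of fun i j => pd a (fun z => G z i j) y with hD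
  set I : Matrix (Fin m) (Fin m) ℝ := Matrix.of fun i j => pd a (invMetric G i j) y with hI
  have h0 : I * G y + (G y)⁻¹ * D = 0 := by
    ext i j
    have hc : (fun z => ∑ q, invMetric G i q z * G z q j)
        =ᶠ[𝓝 y] fun _ => (1 : Matrix (Fin m) (Fin m) ℝ) i j := by
      filter_upwards [hG.posDef] with z hz
      rw [← Matrix.nonsing_inv_mul _ hz.det_pos.ne'.isUnit, Matrix.mul_apply]
      rfl
    have h1 := (hc.pd a).self_of_nhds
    rw [pd_const, pd_sum _ fun q _ =>
      (hG.contDiffAt_invMetric i q).differentiableAt_top.fun_mul (hG.differentiableAt q j)] at h1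
    simp only [pd_mul (hG.contDiffAt_invMetric _ _).differentiableAt_top
      (hG.differentiableAt _ _), Finset.sum_add_distrib] at h1
    rw [Matrix.add_apply, Matrix.mul_apply, Matrix.mul_apply]
    exact h1
  have h2 : I = -((G y)⁻¹ * D * (G y)⁻¹) := by
    have h3 : I * G y * (G y)⁻¹ = I := by rw [Matrix.mul_assoc, hG.mul_inv, Matrix.mul_one]
    rw [← h3, eq_neg_of_add_eq_zero_left h0, Matrix.neg_mul]
  have h4 := congrFun (congrFun h2 k) l
  rw [Matrix.neg_apply, Matrix.mul_apply] at h4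
  simp only [Matrix.mul_apply, Finset.sum_mul] at h4
  rw [Finset.sum_comm] at h4
  exact h4

end MetricAt

/-! ### Gradient and Hessian in coordinates -/

/-- The Christoffel symbols of the first kind, `Γ_l,ij = 1/2 (∂_i g_jl + ∂_j g_il - ∂_l g_ij)`. -/
def christoffelLow (G : Coord m → Matrix (Fin m) (Fin m) ℝ) (l i j : Fin m) (y : Coord m) : ℝ :=
  (1 / 2) * (pd i (fun z => G z j l) y + pd j (fun z => G z i l) y - pd l (fun z => G z i j) y)

/-- The components `∑ l, g^kl ∂_l f` of the gradient. -/
def grad (G : Coord m → Matrix (Fin m) (Fin m) ℝ) (f : Coord m → ℝ) (k : Fin m)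
    (y : Coord m) : ℝ :=
  ∑ l, invMetric G k l y * pd l f y

/-- The inner product `⟨∇ a, ∇ b⟩ = ∑ i j, g^ij ∂_i a ∂_j b` of two gradients. -/
def gradProd (G : Coord m → Matrix (Fin m) (Fin m) ℝ) (a b : Coord m → ℝ) (y : Coord m) : ℝ :=
  ∑ i, ∑ j, invMetric G i j y * pd i a y * pd j b y

theorem gradSq_eq_gradProd (G : Coord m → Matrix (Fin m) (Fin m) ℝ) (f : Coord m → ℝ) :
    gradSq G f = gradProd G f f := rfl

theorem gradProd_eq_sum_grad (G : Coord m → Matrix (Fin m) (Fin m) ℝ) (a b : Coord m → ℝ)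
    (y : Coord m) : gradProd G a b y = ∑ k, pd k a y * grad G b k y := by
  simp only [gradProd, grad, Finset.mul_sum]
  exact Finset.sum_congr rfl fun i _ => Finset.sum_congr rfl fun j _ => by ring

theorem christoffel_eq_sum (G : Coord m → Matrix (Fin m) (Fin m) ℝ) (k i j : Fin m)
    (y : Coord m) :
    christoffel G k i j y = ∑ l, invMetric G k l y * christoffelLow G l i j y := by
  simp only [christoffel, christoffelLow, Finset.mul_sum]
  exact Finset.sum_congr rfl fun l _ => by ring

namespace MetricAt

variable {G : Coord m → Matrix (Fin m) (Fin m) ℝ} {y : Coord m} {f : Coord m → ℝ}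

theorem christoffel_symm (hG : MetricAt G y) (k i j : Fin m) :
    christoffel G k i j y = christoffel G k j i y := by
  simp only [christoffel]
  congr 1
  refine Finset.sum_congr rfl fun l _ => ?_
  rw [hG.pd_symm l i j]
  ring

theorem contDiffAt_christoffel (hG : MetricAt G y) (k i j : Fin m) :
    ContDiffAt ℝ ∞ (christoffel G k i j) y :=
  contDiffAt_const.mul (ContDiffAt.sum fun l _ => (hG.contDiffAt_invMetric k l).mul
    ((((hG.smooth j l).pd i).add ((hG.smooth i l).pd j)).sub ((hG.smooth i j).pd l)))

theorem contDiffAt_grad (hG : MetricAt G y) (hf : ContDiffAt ℝ ∞ f y) (k : Fin m) :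
    ContDiffAt ℝ ∞ (grad G f k) y :=
  ContDiffAt.sum fun l _ => (hG.contDiffAt_invMetric k l).mul (hf.pd l)

theorem contDiffAt_gradProd (hG : MetricAt G y) {a b : Coord m → ℝ} (ha : ContDiffAt ℝ ∞ a y)
    (hb : ContDiffAt ℝ ∞ b y) : ContDiffAt ℝ ∞ (gradProd G a b) y :=
  ContDiffAt.sum fun i _ => ContDiffAt.sum fun j _ =>
    ((hG.contDiffAt_invMetric i j).mul (ha.pd i)).mul (hb.pd j)

theorem contDiffAt_hess (hG : MetricAt G y) (hf : ContDiffAt ℝ ∞ f y) (i j : Fin m) :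
    ContDiffAt ℝ ∞ (hess G f i j) y :=
  ((hf.pd j).pd i).sub (ContDiffAt.sum fun k _ => (hG.contDiffAt_christoffel k i j).mul (hf.pd k))

theorem contDiffAt_laplace (hG : MetricAt G y) (hf : ContDiffAt ℝ ∞ f y) :
    ContDiffAt ℝ ∞ (laplace G f) y :=
  ContDiffAt.sum fun i _ => ContDiffAt.sum fun j _ =>
    (hG.contDiffAt_invMetric i j).mul (hG.contDiffAt_hess hf i j)

theorem contDiffAt_hessSq (hG : MetricAt G y) (hf : ContDiffAt ℝ ∞ f y) :
    ContDiffAt ℝ ∞ (hessSq G f) y :=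
  ContDiffAt.sum fun i _ => ContDiffAt.sum fun j _ => ContDiffAt.sum fun k _ =>
    ContDiffAt.sum fun l _ => (((hG.contDiffAt_invMetric i k).mul
      (hG.contDiffAt_invMetric j l)).mul (hG.contDiffAt_hess hf i j)).mul
        (hG.contDiffAt_hess hf k l)

theorem contDiffAt_covDeriv_grad (hG : MetricAt G y) (hf : ContDiffAt ℝ ∞ f y) (k i : Fin m) :
    ContDiffAt ℝ ∞ (covDeriv (christoffel G) (grad G f) k i) y :=
  ((hG.contDiffAt_grad hf k).pd i).add (ContDiffAt.sum fun s _ =>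
    (hG.contDiffAt_christoffel k i s).mul (hG.contDiffAt_grad hf s))

theorem contDiffAt_bochnerField (hG : MetricAt G y) (hf : ContDiffAt ℝ ∞ f y) (i : Fin m) :
    ContDiffAt ℝ ∞ (bochnerField (christoffel G) (grad G f) i) y :=
  (ContDiffAt.sum fun k _ => (hG.contDiffAt_covDeriv_grad hf i k).mul
    (hG.contDiffAt_grad hf k)).sub
    ((ContDiffAt.sum fun k _ => hG.contDiffAt_covDeriv_grad hf k k).mul (hG.contDiffAt_grad hf i))

theorem hess_symm (hG : MetricAt G y) (hf : ContDiffAt ℝ ∞ f y) (i j : Fin m) :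
    hess G f i j y = hess G f j i y := by
  simp only [hess, pd_comm hf i j, hG.christoffel_symm _ i j]

/-- The Levi-Civita connection is compatible with the metric. -/
theorem pd_eq_christoffelLow_add (hG : MetricAt G y) (i l q : Fin m) :
    pd i (fun z => G z l q) y = christoffelLow G l i q y + christoffelLow G q i l y := by
  simp only [christoffelLow]
  rw [hG.pd_symm i l q]
  ring

theorem sum_christoffel_mul_pd (hG : MetricAt G y) (i j : Fin m) :
    ∑ k, christoffel G k i j y * pd k f y = ∑ r, christoffelLow G r i j y * grad G f r y := by
  simp only [christoffel_eq_sum, grad, Finset.mul_sum, Finset.sum_mul]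
  rw [Finset.sum_comm]
  exact Finset.sum_congr rfl fun r _ => Finset.sum_congr rfl fun k _ => by
    rw [hG.invMetric_symm k r]; ring

/-- The covariant derivative of the gradient is the Hessian with one index raised. -/
theorem covDeriv_grad (hG : MetricAt G y) (hf : ContDiffAt ℝ ∞ f y) (k i : Fin m) :
    covDeriv (christoffel G) (grad G f) k i y = ∑ l, invMetric G k l y * hess G f i l y := by
  have h1 : pd i (grad G f k) y = ∑ l, (pd i (invMetric G k l) y * pd l f y
      + invMetric G k l y * pd i (pd l f) y) := by
    have := pd_sum Finset.univ (fun l _ =>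
      (hG.contDiffAt_invMetric k l).differentiableAt_top.fun_mul
      (hf.pd l).differentiableAt_top) i
    refine Eq.trans this (Finset.sum_congr rfl fun l _ => ?_)
    rw [pd_mul (hG.contDiffAt_invMetric k l).differentiableAt_top (hf.pd l).differentiableAt_top]
  have h2 : ∑ l, pd i (invMetric G k l) y * pd l f y
      = - ∑ q, invMetric G k q y * ∑ r, christoffelLow G q i r y * grad G f r y
        - ∑ q, invMetric G k q y * ∑ r, christoffelLow G r i q y * grad G f r y := by
    rw [← neg_add', ← Finset.sum_add_distrib]
    simp only [hG.pd_invMetric, neg_mul, Finset.sum_neg_distrib, Finset.sum_mul]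
    rw [Finset.sum_comm]
    congr 1
    refine Finset.sum_congr rfl fun q _ => ?_
    rw [Finset.sum_comm, ← mul_add, ← Finset.sum_add_distrib, Finset.mul_sum]
    refine Finset.sum_congr rfl fun r _ => ?_
    rw [← add_mul, ← hG.pd_eq_christoffelLow_add, grad, Finset.mul_sum, Finset.mul_sum]
    exact Finset.sum_congr rfl fun l _ => by ring
  have h3 : ∑ s, christoffel G k i s y * grad G f s y
      = ∑ q, invMetric G k q y * ∑ r, christoffelLow G q i r y * grad G f r y := by
    simp only [christoffel_eq_sum, Finset.sum_mul, Finset.mul_sum]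
    rw [Finset.sum_comm]
    exact Finset.sum_congr rfl fun q _ => Finset.sum_congr rfl fun r _ => by ring
  rw [covDeriv, h1, Finset.sum_add_distrib, h2, h3]
  simp only [hess, hG.sum_christoffel_mul_pd, mul_sub, Finset.sum_sub_distrib]
  ring

theorem sum_covDeriv_grad (hG : MetricAt G y) (hf : ContDiffAt ℝ ∞ f y) :
    ∑ k, covDeriv (christoffel G) (grad G f) k k y = laplace G f y := by
  simp only [hG.covDeriv_grad hf, laplace]

theorem sum_covDeriv_grad_mul (hG : MetricAt G y) (hf : ContDiffAt ℝ ∞ f y) :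
    ∑ i, ∑ k, covDeriv (christoffel G) (grad G f) i k y * covDeriv (christoffel G) (grad G f) k i y
      = hessSq G f y := by
  simp only [hG.covDeriv_grad hf, hessSq, Finset.sum_mul_sum]
  refine Finset.sum_congr rfl fun i _ => ?_
  trans ∑ k, ∑ j, ∑ l, invMetric G i l y * hess G f k l y * (invMetric G k j y * hess G f i j y)
  · exact Finset.sum_congr rfl fun k _ => Finset.sum_comm
  rw [Finset.sum_comm]
  refine Finset.sum_congr rfl fun j _ => ?_
  rw [Finset.sum_comm]
  exact Finset.sum_congr rfl fun k _ => Finset.sum_congr rfl fun l _ => by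
    rw [hG.invMetric_symm l j, hG.hess_symm hf l k]; ring

/-- `∂_l ⟨∇ a, ∇ b⟩ = Hess a (∂_l, ∇ b) + Hess b (∂_l, ∇ a)`. -/
theorem pd_gradProd (hG : MetricAt G y) {a b : Coord m → ℝ} (ha : ContDiffAt ℝ ∞ a y)
    (hb : ContDiffAt ℝ ∞ b y) (l : Fin m) :
    pd l (gradProd G a b) y
      = ∑ k, hess G a l k y * grad G b k y + ∑ k, hess G b l k y * grad G a k y := by
  have h0 : gradProd G a b = fun z => ∑ k, pd k a z * grad G b k z :=
    funext fun z => gradProd_eq_sum_grad G a b z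
  have h1 : ∀ k, pd l (grad G b k) y = ∑ q, invMetric G k q y * hess G b l q y
      - ∑ s, christoffel G k l s y * grad G b s y := by
    intro k
    rw [← hG.covDeriv_grad hb, covDeriv]
    ring
  rw [h0, pd_sum _ fun k _ => (ha.pd k).differentiableAt_top.fun_mul
    (hG.contDiffAt_grad hb k).differentiableAt_top]
  simp only [pd_mul (ha.pd _).differentiableAt_top (hG.contDiffAt_grad hb _).differentiableAt_top,
    h1, mul_sub, Finset.sum_add_distrib, Finset.sum_sub_distrib]
  have h2 : ∑ k, pd k a y * ∑ q, invMetric G k q y * hess G b l q y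
      = ∑ k, hess G b l k y * grad G a k y := by
    simp only [grad, Finset.mul_sum]
    rw [Finset.sum_comm]
    exact Finset.sum_congr rfl fun q _ => Finset.sum_congr rfl fun k _ => by
      rw [hG.invMetric_symm k q]; ring
  have h3 : ∑ k, pd k a y * ∑ s, christoffel G k l s y * grad G b s y
      = ∑ s, (∑ k, christoffel G k l s y * pd k a y) * grad G b s y := by
    simp only [Finset.mul_sum, Finset.sum_mul]
    rw [Finset.sum_comm]
    exact Finset.sum_congr rfl fun q _ => Finset.sum_congr rfl fun k _ => by ring
  simp only [hess, sub_mul, Finset.sum_sub_distrib] at h2 ⊢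
  rw [h2, h3]
  ring

/-- `⟨∇ a, ∇ ⟨∇ b, ∇ c⟩⟩ = Hess b (∇ a, ∇ c) + Hess c (∇ a, ∇ b)`. -/
theorem gradProd_gradProd (hG : MetricAt G y) (a : Coord m → ℝ) {b c : Coord m → ℝ}
    (hb : ContDiffAt ℝ ∞ b y) (hc : ContDiffAt ℝ ∞ c y) :
    gradProd G a (gradProd G b c) y
      = ∑ i, ∑ j, hess G b i j y * grad G a i y * grad G c j y
        + ∑ i, ∑ j, hess G c i j y * grad G a i y * grad G b j y := by
  have h : gradProd G a (gradProd G b c) y = ∑ j, grad G a j y * pd j (gradProd G b c) y := by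
    simp only [gradProd, grad, Finset.sum_mul]
    rw [Finset.sum_comm]
    exact Finset.sum_congr rfl fun j _ => Finset.sum_congr rfl fun i _ => by
      rw [hG.invMetric_symm i j]
  rw [h]
  simp only [hG.pd_gradProd hb hc, mul_add, Finset.sum_add_distrib, Finset.mul_sum]
  congr 1 <;> exact Finset.sum_congr rfl fun j _ => Finset.sum_congr rfl fun i _ => by ring

/-! ### Divergences -/

theorem sum_christoffel_diag (hG : MetricAt G y) (i : Fin m) :
    ∑ s, christoffel G s s i y
      = (1 / 2) * ∑ k, ∑ l, invMetric G k l y * pd i (fun z => G z l k) y := by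
  have h : ∑ s, ∑ l, invMetric G s l y * pd s (fun z => G z i l) y
      = ∑ s, ∑ l, invMetric G s l y * pd l (fun z => G z s i) y := by
    rw [Finset.sum_comm]
    exact Finset.sum_congr rfl fun l _ => Finset.sum_congr rfl fun s _ => by
      rw [hG.invMetric_symm s l, hG.pd_symm s i l]
  simp only [christoffel, ← Finset.mul_sum]
  congr 1
  simp only [mul_sub, mul_add, Finset.sum_add_distrib, Finset.sum_sub_distrib, h]
  rw [add_sub_cancel_left]
  exact Finset.sum_congr rfl fun l _ => Finset.sum_congr rfl fun s _ => by rw [hG.pd_symm i s l]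

theorem contDiffAt_sqrt_det (hG : MetricAt G y) : ContDiffAt ℝ ∞ (fun z => √(G z).det) y :=
  (contDiffAt_det hG.smooth).sqrt hG.det_pos.ne'

/-- `∂_i √(det g) = √(det g) ∑ s, Γ^s_si`. -/
theorem pd_sqrt_det (hG : MetricAt G y) (i : Fin m) :
    pd i (fun z => √(G z).det) y = √(G y).det * ∑ s, christoffel G s s i y := by
  have hd := hG.det_pos
  have h1 : pd i (fun z => √(G z).det) y = 1 / (2 * √(G y).det) * pd i (fun z => (G z).det) y := by
    rw [pd, fderiv_sqrt (contDiffAt_det hG.smooth).differentiableAt_top hd.ne']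
    rfl
  have h2 : pd i (fun z => (G z).det) y
      = (G y).det * ∑ k, ∑ l, invMetric G k l y * pd i (fun z => G z l k) y := by
    rw [pd_det hG.differentiableAt]
    simp only [Finset.mul_sum, invMetric, Matrix.inv_def, Matrix.smul_apply, smul_eq_mul,
      Ring.inverse_eq_inv']
    refine Finset.sum_congr rfl fun k _ => Finset.sum_congr rfl fun l _ => ?_
    field_simp
  rw [h1, h2, hG.sum_christoffel_diag]
  have h3 : √(G y).det * √(G y).det = (G y).det := Real.mul_self_sqrt hd.le
  have h4 : √(G y).det ≠ 0 := (Real.sqrt_pos.2 hd).ne'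
  field_simp
  rw [sq, h3]

/-- The divergence of the vector field `w W`, multiplied by the volume density. -/
theorem sum_pd_sqrt_det_mul (hG : MetricAt G y) {w : Coord m → ℝ} (hw : ContDiffAt ℝ ∞ w y)
    {W : Fin m → Coord m → ℝ} (hW : ∀ i, ContDiffAt ℝ ∞ (W i) y) :
    ∑ i, pd i (fun z => √(G z).det * (w z * W i z)) y
      = √(G y).det * (w y * ∑ i, (pd i (W i) y + (∑ s, christoffel G s s i y) * W i y)
        + ∑ i, pd i w y * W i y) := by
  rw [Finset.mul_sum, ← Finset.sum_add_distrib, Finset.mul_sum]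
  refine Finset.sum_congr rfl fun i _ => ?_
  rw [pd_mul hG.contDiffAt_sqrt_det.differentiableAt_top (hw.mul (hW i)).differentiableAt_top,
    pd_mul hw.differentiableAt_top (hW i).differentiableAt_top, hG.pd_sqrt_det]
  ring

/-- The Laplace-Beltrami operator is the divergence of the gradient. -/
theorem divergence_grad (hG : MetricAt G y) (hf : ContDiffAt ℝ ∞ f y) :
    ∑ i, (pd i (grad G f i) y + (∑ s, christoffel G s s i y) * grad G f i y) = laplace G f y := by
  rw [← hG.sum_covDeriv_grad hf]
  simp only [covDeriv, Finset.sum_add_distrib, Finset.sum_mul]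
  congr 1
  rw [Finset.sum_comm]

/-- **Bochner's identity** in divergence form. -/
theorem divergence_bochnerField (hG : MetricAt G y) (hf : ContDiffAt ℝ ∞ f y) :
    ∑ i, (pd i (bochnerField (christoffel G) (grad G f) i) y
        + (∑ s, christoffel G s s i y) * bochnerField (christoffel G) (grad G f) i y)
      = hessSq G f y - laplace G f y ^ 2
        + ∑ i, ∑ j, ricci G i j y * grad G f i y * grad G f j y := by
  rw [sum_pd_bochnerField hG.contDiffAt_christoffel (hG.contDiffAt_grad hf) hG.christoffel_symm,
    hG.sum_covDeriv_grad hf, hG.sum_covDeriv_grad_mul hf]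
  rfl

/-- The pairing of `dw` with the Bochner field of `∇ f`, in terms of inner products of gradients and
the Laplacian only: in this form it is visibly independent of the coordinates. -/
theorem sum_pd_mul_bochnerField (hG : MetricAt G y) (hf : ContDiffAt ℝ ∞ f y) (w : Coord m → ℝ) :
    ∑ i, pd i w y * bochnerField (christoffel G) (grad G f) i y
      = 1 / 2 * gradProd G w (gradProd G f f) y - laplace G f y * gradProd G w f y := by
  have h1 : ∑ i, pd i w y * ∑ k, (∑ l, invMetric G i l y * hess G f k l y) * grad G f k y
      = ∑ l, ∑ k, hess G f l k y * grad G w l y * grad G f k y := by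
    have h0 : ∀ l, grad G w l y = ∑ i, pd i w y * invMetric G i l y := fun l =>
      Finset.sum_congr rfl fun i _ => by rw [hG.invMetric_symm l i, mul_comm]
    simp only [h0, Finset.mul_sum, Finset.sum_mul]
    trans ∑ k, ∑ l, ∑ i, pd i w y * (invMetric G i l y * hess G f k l y * grad G f k y)
    · rw [Finset.sum_comm]
      exact Finset.sum_congr rfl fun k _ => Finset.sum_comm
    rw [Finset.sum_comm]
    exact Finset.sum_congr rfl fun l _ => Finset.sum_congr rfl fun k _ =>
      Finset.sum_congr rfl fun i _ => by rw [hG.hess_symm hf k l]; ring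
  rw [hG.gradProd_gradProd w hf hf, gradProd_eq_sum_grad]
  simp only [bochnerField, hG.sum_covDeriv_grad hf]
  simp only [hG.covDeriv_grad hf, mul_sub, Finset.sum_sub_distrib]
  rw [h1, Finset.mul_sum]
  simp only [mul_left_comm (laplace G f y)]
  ring

/-- `g(∇ f, ∇ f) = |∇ f|²`, the left side being computed with the lower-index metric. -/
theorem sum_sum_mul_grad (hG : MetricAt G y) :
    ∑ i, ∑ j, G y i j * grad G f i y * grad G f j y = gradSq G f y := by
  have h1 : ∀ i, ∑ j, G y i j * grad G f j y = pd i f y := by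
    intro i
    have : (G y).mulVec ((G y)⁻¹.mulVec fun l => pd l f y) i = pd i f y := by
      rw [Matrix.mulVec_mulVec, hG.mul_inv, Matrix.one_mulVec]
    exact this
  rw [gradSq_eq_gradProd, gradProd_eq_sum_grad]
  refine Finset.sum_congr rfl fun i _ => ?_
  rw [← h1, Finset.sum_mul]
  exact Finset.sum_congr rfl fun j _ => by ring

end MetricAt

end MetricAt

/-! ### Change of coordinates -/

section CoordinateChange

variable {m : ℕ}

/-- The Jacobian matrix of a map between coordinate spaces. -/
def jacobian (T : Coord m → Coord m) (y : Coord m) : Matrix (Fin m) (Fin m) ℝ :=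
  Matrix.of fun p i => pd i (fun z => T z p) y

theorem jacobian_eq_fderiv {T : Coord m → Coord m} {y : Coord m} (hT : DifferentiableAt ℝ T y)
    (p i : Fin m) : jacobian T y p i = fderiv ℝ T y (EuclideanSpace.single i 1) p := by
  have h := (EuclideanSpace.proj p : Coord m →L[ℝ] ℝ).hasFDerivAt.comp y
    hT.hasFDerivAt
  have h2 : fderiv ℝ (fun z => T z p) y
      = (EuclideanSpace.proj p : Coord m →L[ℝ] ℝ).comp (fderiv ℝ T y) := h.fderiv
  simp only [jacobian, Matrix.of_apply, pd, h2]
  rfl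

theorem fderiv_eq_sum_pd (a : Coord m → ℝ) (y v : Coord m) :
    fderiv ℝ a y v = ∑ p, pd p a y * v p := by
  conv_lhs => rw [← (EuclideanSpace.basisFun (Fin m) ℝ).sum_repr v]
  simp [pd, mul_comm]

/-- The chain rule. -/
theorem pd_comp {T : Coord m → Coord m} {y : Coord m} {a : Coord m → ℝ}
    (ha : DifferentiableAt ℝ a (T y)) (hT : DifferentiableAt ℝ T y) (i : Fin m) :
    pd i (a ∘ T) y = ∑ p, pd p a (T y) * jacobian T y p i := by
  rw [pd, fderiv_comp y ha hT, ContinuousLinearMap.comp_apply, fderiv_eq_sum_pd]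
  simp only [jacobian_eq_fderiv hT]

/-- If `A = Jᵀ B J` is invertible then so are `J` and `B`, and `B⁻¹ = J A⁻¹ Jᵀ`: the inverse of a
metric transforms contravariantly. -/
theorem mul_inv_mul_transpose {J A B : Matrix (Fin m) (Fin m) ℝ} (hA : A.det ≠ 0)
    (h : A = J.transpose * B * J) : J * A⁻¹ * J.transpose = B⁻¹ := by
  have hJ : IsUnit J.det := by
    rw [isUnit_iff_ne_zero]
    intro h0
    exact hA (by rw [h, Matrix.det_mul, h0, mul_zero])
  have hJt : IsUnit J.transpose.det := by rwa [Matrix.det_transpose]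
  rw [h, Matrix.mul_inv_rev, Matrix.mul_inv_rev, ← Matrix.mul_assoc, Matrix.mul_nonsing_inv _ hJ,
    Matrix.one_mul, Matrix.mul_assoc, Matrix.nonsing_inv_mul _ hJt, Matrix.mul_one]

/-- `T` is a change of coordinates near `y` which pulls the metric `G'` back to the metric `G`. -/
structure CoordChange (T : Coord m → Coord m) (G G' : Coord m → Matrix (Fin m) (Fin m) ℝ)
    (y : Coord m) : Prop where
  smooth : ContDiffAt ℝ ∞ T y
  metric : MetricAt G y
  metric' : MetricAt G' (T y)
  pullback : ∀ᶠ z in 𝓝 y, G z = (jacobian T z).transpose * G' (T z) * jacobian T z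

theorem gradProd_eq_matrix (G : Coord m → Matrix (Fin m) (Fin m) ℝ) (a b : Coord m → ℝ)
    (y : Coord m) :
    gradProd G a b y = (fun i => pd i a y) ⬝ᵥ ((G y)⁻¹.mulVec fun j => pd j b y) := by
  rw [gradProd_eq_sum_grad]
  rfl

/-- The inner product of two gradients does not depend on the coordinates. -/
theorem gradProd_comp {T : Coord m → Coord m} {G G' : Coord m → Matrix (Fin m) (Fin m) ℝ}
    {y : Coord m} {a b : Coord m → ℝ} (hT : DifferentiableAt ℝ T y) (hG : (G y).det ≠ 0)
    (h : G y = (jacobian T y).transpose * G' (T y) * jacobian T y)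
    (ha : DifferentiableAt ℝ a (T y)) (hb : DifferentiableAt ℝ b (T y)) :
    gradProd G (a ∘ T) (b ∘ T) y = gradProd G' a b (T y) := by
  have hv : ∀ {c : Coord m → ℝ}, DifferentiableAt ℝ c (T y) → (fun i => pd i (c ∘ T) y)
      = (jacobian T y).transpose.mulVec fun p => pd p c (T y) := by
    intro c hc
    funext i
    rw [pd_comp hc hT]
    exact Finset.sum_congr rfl fun p _ => mul_comm _ _
  rw [gradProd_eq_matrix, gradProd_eq_matrix, hv ha, hv hb, ← mul_inv_mul_transpose hG h,
    ← Matrix.mulVec_mulVec, ← Matrix.mulVec_mulVec, Matrix.mulVec_transpose,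
    Matrix.dotProduct_mulVec _ (jacobian T y)]

/-- `Hess f (∇ a, ∇ b)` in terms of inner products of gradients only. -/
theorem MetricAt.sum_hess_mul_grad {G : Coord m → Matrix (Fin m) (Fin m) ℝ} {y : Coord m}
    {f a b : Coord m → ℝ} (hG : MetricAt G y) (hf : ContDiffAt ℝ ∞ f y) (ha : ContDiffAt ℝ ∞ a y)
    (hb : ContDiffAt ℝ ∞ b y) :
    ∑ i, ∑ j, hess G f i j y * grad G a i y * grad G b j y
      = 1 / 2 * (gradProd G a (gradProd G f b) y + gradProd G b (gradProd G f a) y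
        - gradProd G f (gradProd G a b) y) := by
  have hswap : ∀ {u v w : Coord m → ℝ}, ContDiffAt ℝ ∞ u y →
      ∑ i, ∑ j, hess G u i j y * grad G v i y * grad G w j y
        = ∑ i, ∑ j, hess G u i j y * grad G w i y * grad G v j y := by
    intro u v w hu
    rw [Finset.sum_comm]
    exact Finset.sum_congr rfl fun i _ => Finset.sum_congr rfl fun j _ => by
      rw [hG.hess_symm hu]; ring
  rw [hG.gradProd_gradProd a hf hb, hG.gradProd_gradProd b hf ha, hG.gradProd_gradProd f ha hb,
    hswap (v := b) (w := a) hf, hswap (u := b) (v := a) (w := f) hb,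
    hswap (u := a) (v := b) (w := f) ha]
  ring

/-- The matrix `Hess_ij f`. -/
def hessMatrix (G : Coord m → Matrix (Fin m) (Fin m) ℝ) (f : Coord m → ℝ) (y : Coord m) :
    Matrix (Fin m) (Fin m) ℝ :=
  Matrix.of fun i j => hess G f i j y

theorem laplace_eq_trace (G : Coord m → Matrix (Fin m) (Fin m) ℝ) (f : Coord m → ℝ)
    (y : Coord m) : laplace G f y = ((G y)⁻¹ * (hessMatrix G f y).transpose).trace := by
  simp [laplace, invMetric, hessMatrix, Matrix.trace, Matrix.mul_apply]

theorem hessSq_eq_trace (G : Coord m → Matrix (Fin m) (Fin m) ℝ) (f : Coord m → ℝ)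
    (y : Coord m) : hessSq G f y
      = (hessMatrix G f y * (G y)⁻¹ * (hessMatrix G f y).transpose * (G y)⁻¹.transpose).trace := by
  simp only [hessSq, invMetric, hessMatrix, Matrix.trace, Matrix.diag_apply, Matrix.mul_apply,
    Matrix.transpose_apply, Matrix.of_apply, Finset.sum_mul]
  refine Finset.sum_congr rfl fun i _ => ?_
  rw [Finset.sum_comm]
  refine Finset.sum_congr rfl fun k _ => ?_
  rw [Finset.sum_comm]
  exact Finset.sum_congr rfl fun l _ => Finset.sum_congr rfl fun j _ => by ring

theorem sum_hess_mul_grad_eq_matrix {G : Coord m → Matrix (Fin m) (Fin m) ℝ} {y : Coord m}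
    (hG : MetricAt G y) (f a b : Coord m → ℝ) :
    ∑ i, ∑ j, hess G f i j y * grad G a i y * grad G b j y
      = (fun k => pd k a y) ⬝ᵥ
        ((G y)⁻¹ * hessMatrix G f y * (G y)⁻¹).mulVec fun k => pd k b y := by
  have h : ∀ c : Coord m → ℝ, (fun i => grad G c i y) = (G y)⁻¹.mulVec fun k => pd k c y :=
    fun c => rfl
  have h2 : (fun i => grad G a i y) = Matrix.vecMul (fun k => pd k a y) (G y)⁻¹ := by
    rw [h, ← Matrix.vecMul_transpose]
    congr 1
    ext i j
    exact hG.invMetric_symm j i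
  rw [← Matrix.mulVec_mulVec, ← Matrix.mulVec_mulVec, Matrix.dotProduct_mulVec, ← h, ← h2]
  simp only [dotProduct, Matrix.mulVec, hessMatrix, Matrix.of_apply, Finset.mul_sum]
  exact Finset.sum_congr rfl fun i _ => Finset.sum_congr rfl fun j _ => by ring

namespace CoordChange

variable {T : Coord m → Coord m} {G G' : Coord m → Matrix (Fin m) (Fin m) ℝ} {y : Coord m}

theorem eventually_gradProd (h : CoordChange T G G' y) {a b : Coord m → ℝ}
    (ha : ContDiffAt ℝ ∞ a (T y)) (hb : ContDiffAt ℝ ∞ b (T y)) :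
    gradProd G (a ∘ T) (b ∘ T) =ᶠ[𝓝 y] gradProd G' a b ∘ T := by
  have hd : ∀ {c : Coord m → ℝ}, ContDiffAt ℝ ∞ c (T y) →
      ∀ᶠ z in 𝓝 y, DifferentiableAt ℝ c (T z) := fun hc =>
    h.smooth.continuousAt.eventually
      (((hc.of_le (n := ∞) (m := 1) (by simp)).eventually (by simp)).mono
        fun z hz => hz.differentiableAt (by simp))
  have hdT : ∀ᶠ z in 𝓝 y, DifferentiableAt ℝ T z :=
    ((h.smooth.of_le (n := ∞) (m := 1) (by simp)).eventually (by simp)).mono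
        fun z hz => hz.differentiableAt (by simp)
  filter_upwards [hd ha, hd hb, hdT, h.pullback, h.metric.posDef] with z h1 h2 h3 h4 h5
  exact gradProd_comp h3 h5.det_pos.ne' h4 h1 h2

theorem gradProd_eq (h : CoordChange T G G' y) {a b : Coord m → ℝ}
    (ha : ContDiffAt ℝ ∞ a (T y)) (hb : ContDiffAt ℝ ∞ b (T y)) :
    gradProd G (a ∘ T) (b ∘ T) y = gradProd G' a b (T y) :=
  (h.eventually_gradProd ha hb).self_of_nhds

theorem gradProd_gradProd_eq (h : CoordChange T G G' y) {a b c : Coord m → ℝ}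
    (ha : ContDiffAt ℝ ∞ a (T y)) (hb : ContDiffAt ℝ ∞ b (T y)) (hc : ContDiffAt ℝ ∞ c (T y)) :
    gradProd G (a ∘ T) (gradProd G (b ∘ T) (c ∘ T)) y = gradProd G' a (gradProd G' b c) (T y) := by
  have h1 := h.eventually_gradProd hb hc
  have h2 : gradProd G (a ∘ T) (gradProd G (b ∘ T) (c ∘ T)) y
      = gradProd G (a ∘ T) (gradProd G' b c ∘ T) y := by
    simp only [gradProd_eq_matrix (y := y) (a := a ∘ T), (h1.pd _).self_of_nhds]
  rw [h2, h.gradProd_eq ha (h.metric'.contDiffAt_gradProd hb hc)]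

/-- The Hessian is a tensor. Since the inner products of gradients do not depend on the
coordinates, neither does `Hess f (∇ a, ∇ b)`; the coordinate functions serve as `a` and `b`. -/
theorem hessMatrix_eq (h : CoordChange T G G' y) {f : Coord m → ℝ}
    (hf : ContDiffAt ℝ ∞ f (T y)) :
    hessMatrix G (f ∘ T) y
      = (jacobian T y).transpose * hessMatrix G' f (T y) * jacobian T y := by
  set J := jacobian T y with hJdef
  have hpull := h.pullback.self_of_nhds
  have hdet := h.metric.det_pos
  have hinv := mul_inv_mul_transpose hdet.ne' hpull
  rw [← hJdef] at hinv hpull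
  have hcoord : ∀ p : Fin m, ContDiffAt ℝ ∞ (fun w : Coord m => w p) (T y) := fun p =>
    (EuclideanSpace.proj p : Coord m →L[ℝ] ℝ).contDiff.contDiffAt
  have hpd : ∀ p : Fin m, (fun k => pd k (fun w : Coord m => w p) (T y)) = Pi.single p 1 := by
    intro p
    funext k
    have : fderiv ℝ (fun w : Coord m => w p) (T y) = (EuclideanSpace.proj p : Coord m →L[ℝ] ℝ) :=
      (EuclideanSpace.proj p : Coord m →L[ℝ] ℝ).fderiv
    simp [pd, this, Pi.single_apply, eq_comm]
  have key : J * ((G y)⁻¹ * hessMatrix G (f ∘ T) y * (G y)⁻¹) * J.transpose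
      = (G' (T y))⁻¹ * hessMatrix G' f (T y) * (G' (T y))⁻¹ := by
    ext p q
    have hp := hcoord p
    have hq := hcoord q
    have hs : ∀ {c : Coord m → ℝ}, ContDiffAt ℝ ∞ c (T y) → ContDiffAt ℝ ∞ (c ∘ T) y :=
      fun hc => hc.comp y h.smooth
    have e := h.metric.sum_hess_mul_grad (hs hf) (hs hp) (hs hq)
    rw [h.gradProd_gradProd_eq hp hf hq, h.gradProd_gradProd_eq hq hf hp,
      h.gradProd_gradProd_eq hf hp hq, ← h.metric'.sum_hess_mul_grad hf hp hq,
      sum_hess_mul_grad_eq_matrix h.metric, sum_hess_mul_grad_eq_matrix h.metric', hpd p,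
      hpd q] at e
    rw [single_one_dotProduct, Matrix.mulVec_single_one] at e
    refine Eq.trans ?_ e
    rw [Matrix.mul_assoc J]
    rfl
  have hJ : IsUnit J.det := by
    rw [isUnit_iff_ne_zero]
    intro h0
    exact hdet.ne' (by rw [hpull, Matrix.det_mul, h0, mul_zero])
  have hJt : IsUnit J.transpose.det := by rwa [Matrix.det_transpose]
  have hL : G y * J⁻¹ * (J * (G y)⁻¹) = 1 := by
    rw [Matrix.mul_assoc, ← Matrix.mul_assoc J⁻¹, Matrix.nonsing_inv_mul _ hJ, Matrix.one_mul,
      h.metric.mul_inv]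
  have hR : (G y)⁻¹ * J.transpose * (J.transpose⁻¹ * G y) = 1 := by
    rw [Matrix.mul_assoc, ← Matrix.mul_assoc J.transpose, Matrix.mul_nonsing_inv _ hJt,
      Matrix.one_mul, h.metric.inv_mul]
  calc hessMatrix G (f ∘ T) y
      = (G y * J⁻¹ * (J * (G y)⁻¹)) * hessMatrix G (f ∘ T) y
        * ((G y)⁻¹ * J.transpose * (J.transpose⁻¹ * G y)) := by
        rw [hL, hR, Matrix.one_mul, Matrix.mul_one]
    _ = G y * J⁻¹ * (J * ((G y)⁻¹ * hessMatrix G (f ∘ T) y * (G y)⁻¹) * J.transpose)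
        * (J.transpose⁻¹ * G y) := by simp only [Matrix.mul_assoc]
    _ = (G y * J⁻¹ * (J * (G y)⁻¹)) * (J.transpose * hessMatrix G' f (T y) * J)
        * ((G y)⁻¹ * J.transpose * (J.transpose⁻¹ * G y)) := by
        rw [key, ← hinv]; simp only [Matrix.mul_assoc]
    _ = _ := by rw [hL, hR, Matrix.one_mul, Matrix.mul_one]

theorem laplace_eq (h : CoordChange T G G' y) {f : Coord m → ℝ}
    (hf : ContDiffAt ℝ ∞ f (T y)) : laplace G (f ∘ T) y = laplace G' f (T y) := by
  rw [laplace_eq_trace, laplace_eq_trace, h.hessMatrix_eq hf,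
    ← mul_inv_mul_transpose h.metric.det_pos.ne' h.pullback.self_of_nhds]
  simp only [Matrix.transpose_mul, Matrix.transpose_transpose]
  rw [← Matrix.mul_assoc, Matrix.trace_mul_comm, Matrix.mul_assoc, Matrix.trace_mul_comm]
  simp only [Matrix.mul_assoc]

theorem hessSq_eq (h : CoordChange T G G' y) {f : Coord m → ℝ}
    (hf : ContDiffAt ℝ ∞ f (T y)) : hessSq G (f ∘ T) y = hessSq G' f (T y) := by
  rw [hessSq_eq_trace, hessSq_eq_trace, h.hessMatrix_eq hf,
    ← mul_inv_mul_transpose h.metric.det_pos.ne' h.pullback.self_of_nhds]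
  simp only [Matrix.transpose_mul, Matrix.transpose_transpose, Matrix.mul_assoc]
  rw [Matrix.trace_mul_comm]
  simp only [Matrix.mul_assoc]

end CoordChange

namespace MetricAt

variable {G : Coord m → Matrix (Fin m) (Fin m) ℝ} {y : Coord m}

theorem gradSq_nonneg (hG : MetricAt G y) (f : Coord m → ℝ) : 0 ≤ gradSq G f y := by
  rw [gradSq_eq_gradProd, gradProd_eq_matrix]
  simpa using hG.posDef.self_of_nhds.inv.posSemidef.dotProduct_mulVec_nonneg fun k => pd k f y

open scoped MatrixOrder in
theorem hessSq_nonneg (hG : MetricAt G y) (f : Coord m → ℝ) : 0 ≤ hessSq G f y := by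
  obtain ⟨B, hB⟩ : ∃ B : Matrix (Fin m) (Fin m) ℝ, (G y)⁻¹ = B.transpose * B := by
    obtain ⟨B, hB⟩ := CStarAlgebra.nonneg_iff_eq_star_mul_self.1
      hG.posDef.self_of_nhds.inv.posSemidef.nonneg
    exact ⟨B, hB⟩
  have h : hessSq G f y = ((B * hessMatrix G f y * B.transpose)
      * (B * hessMatrix G f y * B.transpose).transpose).trace := by
    rw [hessSq_eq_trace, hB]
    simp only [Matrix.transpose_mul, Matrix.transpose_transpose, Matrix.mul_assoc]
    rw [Matrix.trace_mul_comm B]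
    simp only [Matrix.mul_assoc]
  rw [h]
  exact (Matrix.posSemidef_self_mul_conjTranspose (B * hessMatrix G f y * B.transpose)).trace_nonneg

end MetricAt

end CoordinateChange

/-! ### The metric in a chart -/

section Charts

theorem eventually_symm_mem {m : ℕ} {M : Type*} [TopologicalSpace M]
    {e e' : OpenPartialHomeomorph M (Coord m)} {y : Coord m}
    (hy : y ∈ e.target) (hy' : e.symm y ∈ e'.source) :
    ∀ᶠ z in 𝓝 y, z ∈ e.target ∧ e.symm z ∈ e'.source :=
  (e.open_target.eventually_mem hy).and
    ((e.continuousAt_symm hy).eventually (e'.open_source.mem_nhds hy'))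

variable {m : ℕ} {M : Type*} [TopologicalSpace M] [ChartedSpace (Coord m) M]
  [IsManifold (𝓡 m) ∞ M]

theorem mem_maximalAtlas {e : OpenPartialHomeomorph M (Coord m)} (he : e ∈ atlas (Coord m) M) :
    e ∈ IsManifold.maximalAtlas (𝓡 m) ∞ M :=
  IsManifold.subset_maximalAtlas he

/-- The coordinate vector fields are smooth. -/
theorem contMDiffAt_coordVec {e : OpenPartialHomeomorph M (Coord m)} (he : e ∈ atlas (Coord m) M)
    (i : Fin m) {y : Coord m} (hy : y ∈ e.target) :
    ContMDiffAt (𝓡 m) ((𝓡 m).prod 𝓘(ℝ, Coord m)) ∞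
      (fun z => Bundle.TotalSpace.mk' (Coord m) (E := fun x : M => TangentSpace (𝓡 m) x)
        (e.symm z) (coordVec e i z)) y := by
  have hs : ContMDiffAt (𝓡 m) (𝓡 m) ∞ e.symm y :=
    contMDiffAt_symm_of_mem_maximalAtlas (mem_maximalAtlas he) hy
  have hφ := ContMDiffAt.mfderiv_const (m := ∞) hs (by simp)
  refine ContMDiffAt.clm_apply_of_inCoordinates (F₁ := Coord m) (F₂ := Coord m) (B₁ := Coord m)
    (E₁ := fun z : Coord m => TangentSpace (𝓡 m) z) (E₂ := fun x : M => TangentSpace (𝓡 m) x)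
    (IB₁ := 𝓡 m) (b₁ := fun z : Coord m => z)
    (b₂ := fun z => e.symm z) (v := fun z => (EuclideanSpace.single i (1 : ℝ) : Coord m))
    (ϕ := fun z => mfderiv (𝓡 m) (𝓡 m) e.symm z) hφ ?_ hs
  exact (contMDiffAt_vectorSpace_iff_contDiffAt (𝕜 := ℝ) (E := Coord m)
    (V := fun _ : Coord m => (EuclideanSpace.single i (1 : ℝ) : Coord m))).2 contDiffAt_const

theorem contDiffAt_gram (g : Metric m M) {e : OpenPartialHomeomorph M (Coord m)}
    (he : e ∈ atlas (Coord m) M) {y : Coord m} (hy : y ∈ e.target) (i j : Fin m) :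
    ContDiffAt ℝ ∞ (fun z => gram g e z i j) y := by
  rw [← contMDiffAt_iff_contDiffAt]
  have hs : ContMDiffAt (𝓡 m) (𝓡 m) ∞ e.symm y :=
    contMDiffAt_symm_of_mem_maximalAtlas (mem_maximalAtlas he) hy
  have h : ContMDiffAt (𝓡 m) ((𝓡 m).prod 𝓘(ℝ)) ∞
      (fun z => Bundle.TotalSpace.mk' ℝ (E := Bundle.Trivial M ℝ) (e.symm z)
        (g.inner (e.symm z) (coordVec e i z) (coordVec e j z))) y := by
    apply ContMDiffAt.clm_bundle_apply₂ (F₁ := Coord m) (F₂ := Coord m)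
    · exact ContMDiffAt.comp y g.contMDiff.contMDiffAt hs
    · exact contMDiffAt_coordVec he i hy
    · exact contMDiffAt_coordVec he j hy
  simp only [Bundle.contMDiffAt_totalSpace] at h
  exact h.2

/-- The scalar product `g x`, as a bilinear form on the model space. The tangent spaces at different
points are different types; this common type allows the base point to be rewritten. -/
def metricForm (g : Metric m M) (x : M) : Coord m →L[ℝ] Coord m →L[ℝ] ℝ := g.inner x

/-- The derivative of the inverse of the chart `e`, as a map of the model space; its values on the
standard basis are the vectors `coordVec e i y`. -/
def chartDeriv (e : OpenPartialHomeomorph M (Coord m)) (y : Coord m) : Coord m →L[ℝ] Coord m :=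
  mfderiv (𝓡 m) (𝓡 m) e.symm y

theorem gram_apply (g : Metric m M) (e : OpenPartialHomeomorph M (Coord m)) (y : Coord m)
    (i j : Fin m) : gram g e y i j = metricForm g (e.symm y)
      (chartDeriv e y (EuclideanSpace.single i 1)) (chartDeriv e y (EuclideanSpace.single j 1)) :=
  rfl

theorem sum_single (x : Fin m → ℝ) :
    ∑ i, x i • (EuclideanSpace.single i (1 : ℝ) : Coord m) = WithLp.toLp 2 x := by
  ext j
  simp [Finset.sum_apply, Pi.single_apply]

theorem sum_gram (g : Metric m M) (e : OpenPartialHomeomorph M (Coord m)) (y : Coord m)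
    (a b : Fin m → ℝ) :
    ∑ i, ∑ j, a i * gram g e y i j * b j = metricForm g (e.symm y)
      (chartDeriv e y (WithLp.toLp 2 a)) (chartDeriv e y (WithLp.toLp 2 b)) := by
  rw [← sum_single, ← sum_single]
  simp only [map_sum, map_smul, sum_apply, smul_apply, smul_eq_mul, gram_apply, Finset.mul_sum]
  rw [Finset.sum_comm]
  exact Finset.sum_congr rfl fun i _ => Finset.sum_congr rfl fun j _ => by ring

theorem posDef_gram (g : Metric m M) {e : OpenPartialHomeomorph M (Coord m)}
    (he : e ∈ atlas (Coord m) M) {y : Coord m} (hy : y ∈ e.target) : (gram g e y).PosDef := by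
  refine Matrix.PosDef.of_dotProduct_mulVec_pos ?_ ?_
  · ext i j
    simp only [Matrix.conjTranspose_apply, star_trivial]
    exact g.symm _ _ _
  · intro x hx
    have h1 : star x ⬝ᵥ (gram g e y).mulVec x = ∑ i, ∑ j, x i * gram g e y i j * x j := by
      simp only [dotProduct, Matrix.mulVec, Finset.mul_sum, Pi.star_apply, star_trivial, mul_assoc]
    rw [h1, sum_gram]
    refine g.pos _ _ fun h0 => hx ?_
    have hinj : Function.Injective (chartDeriv e y) :=
      (mdifferentiable_of_mem_atlas he).symm.mfderiv_injective hy
    have h2 : (WithLp.toLp 2 x : Coord m) = 0 := hinj (h0.trans (map_zero (chartDeriv e y)).symm)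
    funext i
    exact congrArg (fun v : Coord m => v i) h2

theorem metricAt_gram (g : Metric m M) {e : OpenPartialHomeomorph M (Coord m)}
    (he : e ∈ atlas (Coord m) M) {y : Coord m} (hy : y ∈ e.target) : MetricAt (gram g e) y where
  smooth := contDiffAt_gram g he hy
  posDef := by
    filter_upwards [e.open_target.mem_nhds hy] with z hz
    exact posDef_gram g he hz

theorem contDiffAt_transition {e e' : OpenPartialHomeomorph M (Coord m)}
    (he : e ∈ atlas (Coord m) M) (he' : e' ∈ atlas (Coord m) M) {y : Coord m} (hy : y ∈ e.target)
    (hy' : e.symm y ∈ e'.source) : ContDiffAt ℝ ∞ (e' ∘ e.symm) y := by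
  rw [← contMDiffAt_iff_contDiffAt]
  exact (contMDiffAt_of_mem_maximalAtlas (mem_maximalAtlas he') hy').comp y
    (contMDiffAt_symm_of_mem_maximalAtlas (mem_maximalAtlas he) hy)

theorem chartDeriv_transition {e e' : OpenPartialHomeomorph M (Coord m)}
    (he : e ∈ atlas (Coord m) M) (he' : e' ∈ atlas (Coord m) M) {y : Coord m} (hy : y ∈ e.target)
    (hy' : e.symm y ∈ e'.source) :
    chartDeriv e y = (chartDeriv e' (e' (e.symm y))).comp (fderiv ℝ (e' ∘ e.symm) y) := by
  have h1 : e.symm =ᶠ[𝓝 y] e'.symm ∘ (e' ∘ e.symm) := by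
    filter_upwards [eventually_symm_mem hy hy'] with z hz
    exact (e'.left_inv hz.2).symm
  have h2 : chartDeriv e y = mfderiv (𝓡 m) (𝓡 m) (e'.symm ∘ (e' ∘ e.symm)) y := h1.mfderiv_eq
  have h3 : MDifferentiableAt (𝓡 m) (𝓡 m) (e' ∘ e.symm) y :=
    (contDiffAt_transition he he' hy hy').contMDiffAt.mdifferentiableAt (by simp)
  have h4 : MDifferentiableAt (𝓡 m) (𝓡 m) e'.symm ((e' ∘ e.symm) y) :=
    mdifferentiableAt_atlas_symm he' (e'.map_source hy')
  rw [h2, mfderiv_comp y h4 h3, mfderiv_eq_fderiv]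
  rfl

theorem gram_transition (g : Metric m M) {e e' : OpenPartialHomeomorph M (Coord m)}
    (he : e ∈ atlas (Coord m) M) (he' : e' ∈ atlas (Coord m) M) {y : Coord m} (hy : y ∈ e.target)
    (hy' : e.symm y ∈ e'.source) :
    gram g e y = (jacobian (e' ∘ e.symm) y).transpose * gram g e' ((e' ∘ e.symm) y)
      * jacobian (e' ∘ e.symm) y := by
  have hT : DifferentiableAt ℝ (e' ∘ e.symm) y :=
    (contDiffAt_transition he he' hy hy').differentiableAt (by simp)
  have hcol : ∀ i, fderiv ℝ (e' ∘ e.symm) y (EuclideanSpace.single i 1)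
      = WithLp.toLp 2 fun p => jacobian (e' ∘ e.symm) y p i := by
    intro i
    ext p
    exact (jacobian_eq_fderiv hT p i).symm
  ext i j
  rw [gram_apply, chartDeriv_transition he he' hy hy', ContinuousLinearMap.comp_apply,
    ContinuousLinearMap.comp_apply, hcol, hcol]
  have h := sum_gram g e' ((e' ∘ e.symm) y) (fun p => jacobian (e' ∘ e.symm) y p i)
    (fun p => jacobian (e' ∘ e.symm) y p j)
  rw [Function.comp_apply, e'.left_inv hy'] at h
  rw [← h]
  simp only [Matrix.mul_apply, Matrix.transpose_apply, Finset.sum_mul]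
  exact Finset.sum_comm

theorem coordChange_transition (g : Metric m M) {e e' : OpenPartialHomeomorph M (Coord m)}
    (he : e ∈ atlas (Coord m) M) (he' : e' ∈ atlas (Coord m) M) {y : Coord m} (hy : y ∈ e.target)
    (hy' : e.symm y ∈ e'.source) : CoordChange (e' ∘ e.symm) (gram g e) (gram g e') y where
  smooth := contDiffAt_transition he he' hy hy'
  metric := metricAt_gram g he hy
  metric' := metricAt_gram g he' (e'.map_source hy')
  pullback := by
    filter_upwards [eventually_symm_mem hy hy'] with z hz
    exact gram_transition g he he' hz.1 hz.2

theorem continuousOn_sqrt_det_gram (g : Metric m M) {e : OpenPartialHomeomorph M (Coord m)}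
    (he : e ∈ atlas (Coord m) M) : ContinuousOn (fun y => √(gram g e y).det) e.target :=
  fun _ hy => (metricAt_gram g he hy).contDiffAt_sqrt_det.continuousAt.continuousWithinAt

end Charts

/-! ### Differential operators on the manifold -/

section Germs

variable {m : ℕ} {G : Coord m → Matrix (Fin m) (Fin m) ℝ} {y : Coord m} {a a' b b' : Coord m → ℝ}

theorem gradProd_congr (ha : a =ᶠ[𝓝 y] a') (hb : b =ᶠ[𝓝 y] b') :
    gradProd G a b y = gradProd G a' b' y := by
  simp only [gradProd, (ha.pd _).self_of_nhds, (hb.pd _).self_of_nhds]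

theorem hess_congr (ha : a =ᶠ[𝓝 y] a') (i j : Fin m) : hess G a i j y = hess G a' i j y := by
  simp only [hess, (ha.pd _).self_of_nhds, ((ha.pd j).pd i).self_of_nhds]

theorem laplace_congr (ha : a =ᶠ[𝓝 y] a') : laplace G a y = laplace G a' y := by
  simp only [laplace, hess_congr ha]

theorem hessSq_congr (ha : a =ᶠ[𝓝 y] a') : hessSq G a y = hessSq G a' y := by
  simp only [hessSq, hess_congr ha]

theorem hess_const (c : ℝ) (i j : Fin m) : hess G (fun _ => c) i j y = 0 := by
  have h : pd j (fun _ : Coord m => c) = fun _ => 0 := funext fun z => pd_const c j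
  simp [hess, h, pd_const]

theorem gradProd_const_left (c : ℝ) : gradProd G (fun _ => c) b y = 0 := by
  simp [gradProd, pd_const]

theorem gradProd_const_right (c : ℝ) : gradProd G b (fun _ => c) y = 0 := by
  simp [gradProd, pd_const]

end Germs

theorem comp_symm_eventuallyEq {m : ℕ} {M : Type*} [TopologicalSpace M] (u : M → ℝ)
    {e e' : OpenPartialHomeomorph M (Coord m)} {y : Coord m} (hy : y ∈ e.target)
    (hy' : e.symm y ∈ e'.source) :
    u ∘ e.symm =ᶠ[𝓝 y] (u ∘ e'.symm) ∘ (e' ∘ e.symm) := by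
  filter_upwards [eventually_symm_mem hy hy'] with z hz
  simp [e'.left_inv hz.2]

section PreferredChart

variable {m : ℕ} {M : Type*} [TopologicalSpace M] [ChartedSpace (Coord m) M] {a a' : M → ℝ} {x : M}
  {e : OpenPartialHomeomorph M (Coord m)}

theorem transition_chartAt (e : OpenPartialHomeomorph M (Coord m)) (x : M) :
    (e ∘ (chartAt (Coord m) x).symm) (chartAt (Coord m) x x) = e x := by
  rw [Function.comp_apply, (chartAt (Coord m) x).left_inv (mem_chart_source _ x)]

theorem comp_symm_chartAt_eventuallyEq (u : M → ℝ) (hx : x ∈ e.source) :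
    u ∘ (chartAt (Coord m) x).symm =ᶠ[𝓝 (chartAt (Coord m) x x)]
      (u ∘ e.symm) ∘ (e ∘ (chartAt (Coord m) x).symm) :=
  comp_symm_eventuallyEq u (mem_chart_target _ x)
    (by rwa [(chartAt (Coord m) x).left_inv (mem_chart_source _ x)])

theorem comp_chartAt_symm_congr (h : a =ᶠ[𝓝 x] a') :
    a ∘ (chartAt (Coord m) x).symm =ᶠ[𝓝 (chartAt (Coord m) x x)]
      a' ∘ (chartAt (Coord m) x).symm := by
  have hc := (chartAt (Coord m) x).continuousAt_symm (mem_chart_target _ x)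
  rw [ContinuousAt, (chartAt (Coord m) x).left_inv (mem_chart_source _ x)] at hc
  exact hc.eventually h

end PreferredChart

section Operators

variable {m : ℕ} {M : Type*} [TopologicalSpace M] [ChartedSpace (Coord m) M]
  [IsManifold (𝓡 m) ∞ M]

/-- The inner product `⟨∇ a, ∇ b⟩` on `M`, computed in the preferred chart at each point. -/
def gradInner (g : Metric m M) (a b : M → ℝ) (x : M) : ℝ :=
  gradProd (gram g (chartAt (Coord m) x)) (a ∘ (chartAt (Coord m) x).symm)
    (b ∘ (chartAt (Coord m) x).symm) (chartAt (Coord m) x x)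

/-- The squared length `|Hess u|²` on `M`, computed in the preferred chart at each point. -/
def hessNormSq (g : Metric m M) (u : M → ℝ) (x : M) : ℝ :=
  hessSq (gram g (chartAt (Coord m) x)) (u ∘ (chartAt (Coord m) x).symm)
    (chartAt (Coord m) x x)

theorem contDiffAt_comp_symm {u : M → ℝ} (hu : ContMDiff (𝓡 m) 𝓘(ℝ, ℝ) ∞ u)
    {e : OpenPartialHomeomorph M (Coord m)} (he : e ∈ atlas (Coord m) M) {y : Coord m}
    (hy : y ∈ e.target) : ContDiffAt ℝ ∞ (u ∘ e.symm) y := by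
  rw [← contMDiffAt_iff_contDiffAt]
  exact hu.contMDiffAt.comp y (contMDiffAt_symm_of_mem_maximalAtlas (mem_maximalAtlas he) hy)

section Invariance

variable (g : Metric m M) {a b : M → ℝ} {e : OpenPartialHomeomorph M (Coord m)} {x : M}

theorem coordChange_chartAt (he : e ∈ atlas (Coord m) M) (hx : x ∈ e.source) :
    CoordChange (e ∘ (chartAt (Coord m) x).symm) (gram g (chartAt (Coord m) x)) (gram g e)
      (chartAt (Coord m) x x) :=
  coordChange_transition g (chart_mem_atlas _ x) he (mem_chart_target _ x)
    (by rwa [(chartAt (Coord m) x).left_inv (mem_chart_source _ x)])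

theorem contDiffAt_comp_symm_transition (ha : ContMDiff (𝓡 m) 𝓘(ℝ, ℝ) ∞ a)
    (he : e ∈ atlas (Coord m) M) (hx : x ∈ e.source) :
    ContDiffAt ℝ ∞ (a ∘ e.symm) ((e ∘ (chartAt (Coord m) x).symm) (chartAt (Coord m) x x)) := by
  rw [transition_chartAt]
  exact contDiffAt_comp_symm ha he (e.map_source hx)

/-- `gradInner` may be computed in any chart of the atlas. -/
theorem gradInner_eq (ha : ContMDiff (𝓡 m) 𝓘(ℝ, ℝ) ∞ a) (hb : ContMDiff (𝓡 m) 𝓘(ℝ, ℝ) ∞ b)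
    (he : e ∈ atlas (Coord m) M) (hx : x ∈ e.source) :
    gradInner g a b x = gradProd (gram g e) (a ∘ e.symm) (b ∘ e.symm) (e x) := by
  rw [gradInner, gradProd_congr (comp_symm_chartAt_eventuallyEq a hx)
    (comp_symm_chartAt_eventuallyEq b hx), (coordChange_chartAt g he hx).gradProd_eq
    (contDiffAt_comp_symm_transition ha he hx) (contDiffAt_comp_symm_transition hb he hx),
    transition_chartAt]

/-- The Laplace-Beltrami operator may be computed in any chart of the atlas. -/
theorem laplacian_eq (ha : ContMDiff (𝓡 m) 𝓘(ℝ, ℝ) ∞ a)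
    (he : e ∈ atlas (Coord m) M) (hx : x ∈ e.source) :
    laplacian g a x = laplace (gram g e) (a ∘ e.symm) (e x) := by
  rw [laplacian, laplace_congr (comp_symm_chartAt_eventuallyEq a hx),
    (coordChange_chartAt g he hx).laplace_eq (contDiffAt_comp_symm_transition ha he hx),
    transition_chartAt]

/-- The length of the Hessian may be computed in any chart of the atlas. -/
theorem hessNormSq_eq (ha : ContMDiff (𝓡 m) 𝓘(ℝ, ℝ) ∞ a)
    (he : e ∈ atlas (Coord m) M) (hx : x ∈ e.source) :
    hessNormSq g a x = hessSq (gram g e) (a ∘ e.symm) (e x) := by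
  rw [hessNormSq, hessSq_congr (comp_symm_chartAt_eventuallyEq a hx),
    (coordChange_chartAt g he hx).hessSq_eq (contDiffAt_comp_symm_transition ha he hx),
    transition_chartAt]

theorem contMDiff_of_charts {F : M → ℝ} (Φ : OpenPartialHomeomorph M (Coord m) → Coord m → ℝ)
    (hF : ∀ e ∈ atlas (Coord m) M, ∀ x ∈ e.source, F x = Φ e (e x))
    (hΦ : ∀ e ∈ atlas (Coord m) M, ∀ y ∈ e.target, ContDiffAt ℝ ∞ (Φ e) y) :
    ContMDiff (𝓡 m) 𝓘(ℝ, ℝ) ∞ F := by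
  intro x
  have he := chart_mem_atlas (Coord m) x
  have h1 : ContMDiffAt (𝓡 m) 𝓘(ℝ, ℝ) ∞ (Φ (chartAt (Coord m) x) ∘ chartAt (Coord m) x) x :=
    (hΦ _ he _ (mem_chart_target _ x)).contMDiffAt.comp x
      (contMDiffAt_of_mem_maximalAtlas (mem_maximalAtlas he) (mem_chart_source _ x))
  refine h1.congr_of_eventuallyEq ?_
  filter_upwards [(chartAt (Coord m) x).open_source.mem_nhds (mem_chart_source _ x)] with z hz
  exact hF _ he z hz

theorem contMDiff_gradInner (ha : ContMDiff (𝓡 m) 𝓘(ℝ, ℝ) ∞ a)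
    (hb : ContMDiff (𝓡 m) 𝓘(ℝ, ℝ) ∞ b) : ContMDiff (𝓡 m) 𝓘(ℝ, ℝ) ∞ (gradInner g a b) :=
  contMDiff_of_charts (fun e => gradProd (gram g e) (a ∘ e.symm) (b ∘ e.symm))
    (fun _ he _ hx => gradInner_eq g ha hb he hx) fun _ he _ hy =>
      (metricAt_gram g he hy).contDiffAt_gradProd (contDiffAt_comp_symm ha he hy)
        (contDiffAt_comp_symm hb he hy)

theorem contMDiff_laplacian (ha : ContMDiff (𝓡 m) 𝓘(ℝ, ℝ) ∞ a) :
    ContMDiff (𝓡 m) 𝓘(ℝ, ℝ) ∞ (laplacian g a) :=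
  contMDiff_of_charts (fun e => laplace (gram g e) (a ∘ e.symm))
    (fun _ he _ hx => laplacian_eq g ha he hx) fun _ he _ hy =>
      (metricAt_gram g he hy).contDiffAt_laplace (contDiffAt_comp_symm ha he hy)

theorem contMDiff_hessNormSq (ha : ContMDiff (𝓡 m) 𝓘(ℝ, ℝ) ∞ a) :
    ContMDiff (𝓡 m) 𝓘(ℝ, ℝ) ∞ (hessNormSq g a) :=
  contMDiff_of_charts (fun e => hessSq (gram g e) (a ∘ e.symm))
    (fun _ he _ hx => hessNormSq_eq g ha he hx) fun _ he _ hy =>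
      (metricAt_gram g he hy).contDiffAt_hessSq (contDiffAt_comp_symm ha he hy)

theorem eventuallyEq_zero_of_notMem_tsupport (hx : x ∉ tsupport a) : a =ᶠ[𝓝 x] fun _ => 0 :=
  notMem_tsupport_iff_eventuallyEq.1 hx

theorem gradInner_congr {a' b' : M → ℝ} (ha : a =ᶠ[𝓝 x] a') (hb : b =ᶠ[𝓝 x] b') :
    gradInner g a b x = gradInner g a' b' x :=
  gradProd_congr (comp_chartAt_symm_congr ha) (comp_chartAt_symm_congr hb)

theorem gradInner_eq_zero_right (hx : x ∉ tsupport b) : gradInner g a b x = 0 := by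
  rw [gradInner_congr g (EventuallyEq.refl _ a) (eventuallyEq_zero_of_notMem_tsupport hx)]
  exact gradProd_const_right 0

theorem gradInner_eq_zero_left (hx : x ∉ tsupport a) : gradInner g a b x = 0 := by
  rw [gradInner_congr g (eventuallyEq_zero_of_notMem_tsupport hx) (EventuallyEq.refl _ b)]
  exact gradProd_const_left 0

theorem laplacian_eq_zero (hx : x ∉ tsupport a) : laplacian g a x = 0 := by
  rw [laplacian, laplace_congr
    (comp_chartAt_symm_congr (eventuallyEq_zero_of_notMem_tsupport hx))]
  simp only [laplace, Function.comp_def, hess_const, mul_zero, Finset.sum_const_zero]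

theorem hessNormSq_eq_zero (hx : x ∉ tsupport a) : hessNormSq g a x = 0 := by
  rw [hessNormSq, hessSq_congr
    (comp_chartAt_symm_congr (eventuallyEq_zero_of_notMem_tsupport hx))]
  simp only [hessSq, Function.comp_def, hess_const, mul_zero, Finset.sum_const_zero]

theorem gradInner_self_nonneg (a : M → ℝ) (x : M) : 0 ≤ gradInner g a a x :=
  (metricAt_gram g (chart_mem_atlas _ x) (mem_chart_target _ x)).gradSq_nonneg _

theorem hessNormSq_nonneg (a : M → ℝ) (x : M) : 0 ≤ hessNormSq g a x :=
  (metricAt_gram g (chart_mem_atlas _ x) (mem_chart_target _ x)).hessSq_nonneg _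

theorem gradNorm_eq_sqrt (a : M → ℝ) (x : M) : gradNorm g a x = √(gradInner g a a x) := rfl

theorem hessNorm_eq_sqrt (a : M → ℝ) (x : M) : hessNorm g a x = √(hessNormSq g a x) := rfl

theorem gradInner_sum_left {ι : Type*} (s : Finset ι) {F : ι → M → ℝ}
    (hF : ∀ i, ContMDiff (𝓡 m) 𝓘(ℝ, ℝ) ∞ (F i)) (b : M → ℝ) (x : M) :
    gradInner g (fun z => ∑ i ∈ s, F i z) b x = ∑ i ∈ s, gradInner g (F i) b x := by
  have hd : ∀ i ∈ s, DifferentiableAt ℝ (F i ∘ (chartAt (Coord m) x).symm)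
      (chartAt (Coord m) x x) := fun i _ =>
    (contDiffAt_comp_symm (hF i) (chart_mem_atlas _ x) (mem_chart_target _ x)).differentiableAt_top
  simp only [gradInner, gradProd_eq_sum_grad]
  rw [Finset.sum_comm]
  refine Finset.sum_congr rfl fun k _ => ?_
  rw [← Finset.sum_mul, ← pd_sum s hd]
  rfl

end Invariance

end Operators

/-! ### The Riemannian measure in a chart -/

section RiemannianMeasure

theorem measurableSet_target_inter {m : ℕ} {M : Type*} [TopologicalSpace M] [MeasurableSpace M]
    [BorelSpace M] (e : OpenPartialHomeomorph M (Coord m)) {A : Set M}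
    (hA : MeasurableSet A) : MeasurableSet (e.target ∩ e.symm ⁻¹' A) := by
  have h1 := (continuousOn_iff_continuous_domRestrict.1 e.continuousOn_symm).measurable hA
  have h2 := e.open_target.measurableSet.subtype_image h1
  convert! h2 using 1
  ext y
  simp [and_comm]

theorem aemeasurable_symm {m : ℕ} {M : Type*} [TopologicalSpace M] [MeasurableSpace M]
    [BorelSpace M] (e : OpenPartialHomeomorph M (Coord m))
    (f : Coord m → ℝ≥0∞) :
    AEMeasurable e.symm ((volume.restrict e.target).withDensity f) := by
  refine AEMeasurable.mono_ac ?_ (withDensity_absolutelyContinuous _ _)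
  have hm := fun A hA => measurableSet_target_inter e (A := A) hA
  rcases e.target.eq_empty_or_nonempty with h | ⟨y₀, hy₀⟩
  · rw [h, Measure.restrict_empty]
    exact aemeasurable_zero_measure
  classical
  refine ⟨e.target.piecewise e.symm fun _ => e.symm y₀, fun A hA => ?_, ?_⟩
  · rw [Set.piecewise_preimage, Set.ite]
    refine MeasurableSet.union ?_ ((measurable_const hA).diff e.open_target.measurableSet)
    rw [Set.inter_comm]
    exact hm A hA
  · exact (ae_restrict_mem e.open_target.measurableSet).mono fun y hy =>
      (Set.piecewise_eq_of_mem _ _ _ hy).symm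

variable {m : ℕ} {M : Type*} [TopologicalSpace M] [ChartedSpace (Coord m) M]
  [IsManifold (𝓡 m) ∞ M] [MeasurableSpace M] [BorelSpace M]

theorem det_fderiv_eq_det_jacobian {T : Coord m → Coord m} {y : Coord m}
    (hT : DifferentiableAt ℝ T y) : (fderiv ℝ T y).det = (jacobian T y).det := by
  rw [ContinuousLinearMap.det,
    ← LinearMap.det_toMatrix (EuclideanSpace.basisFun (Fin m) ℝ).toBasis]
  congr 1
  ext p i
  rw [jacobian_eq_fderiv hT, LinearMap.toMatrix_apply]
  simp

theorem chartMeasure_apply (g : Metric m M) (e : OpenPartialHomeomorph M (Coord m)) {A : Set M}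
    (hA : MeasurableSet A) : chartMeasure g e A
      = ∫⁻ y in e.target ∩ e.symm ⁻¹' A, ENNReal.ofReal √(gram g e y).det := by
  rw [chartMeasure, Measure.map_apply_of_aemeasurable (aemeasurable_symm e _) hA,
    withDensity_apply', Measure.restrict_restrict' e.open_target.measurableSet, Set.inter_comm]

/-- The change of variables formula: two chart measures agree where both charts are defined. -/
theorem chartMeasure_eq (g : Metric m M) {e e' : OpenPartialHomeomorph M (Coord m)}
    (he : e ∈ atlas (Coord m) M) (he' : e' ∈ atlas (Coord m) M) {A : Set M} (hA : MeasurableSet A)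
    (hAe : A ⊆ e.source) (hAe' : A ⊆ e'.source) : chartMeasure g e A = chartMeasure g e' A := by
  rw [chartMeasure_apply g e hA, chartMeasure_apply g e' hA]
  have himage : (e' ∘ e.symm) '' (e.target ∩ e.symm ⁻¹' A) = e'.target ∩ e'.symm ⁻¹' A := by
    ext z
    constructor
    · rintro ⟨y, ⟨hy, hyA⟩, rfl⟩
      refine ⟨e'.map_source (hAe' hyA), ?_⟩
      simpa [e'.left_inv (hAe' hyA)] using hyA
    · rintro ⟨hz, hzA⟩
      refine ⟨e (e'.symm z), ⟨e.map_source (hAe hzA), ?_⟩, ?_⟩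
      · simpa [e.left_inv (hAe hzA)] using hzA
      · simp [e.left_inv (hAe hzA), e'.right_inv hz]
  have hd : ∀ y ∈ e.target ∩ e.symm ⁻¹' A, DifferentiableAt ℝ (e' ∘ e.symm) y := fun y hy =>
    (contDiffAt_transition he he' hy.1 (hAe' hy.2)).differentiableAt (by simp)
  have hinj : Set.InjOn (e' ∘ e.symm) (e.target ∩ e.symm ⁻¹' A) := by
    intro y hy z hz hyz
    exact e.symm.injOn hy.1 hz.1 (e'.injOn (hAe' hy.2) (hAe' hz.2) hyz)
  rw [← himage, lintegral_image_eq_lintegral_abs_det_fderiv_mul volume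
    (measurableSet_target_inter e hA) (fun y hy => (hd y hy).hasFDerivAt.hasFDerivWithinAt) hinj]
  refine setLIntegral_congr_fun (measurableSet_target_inter e hA) fun y hy => ?_
  rw [← ENNReal.ofReal_mul (abs_nonneg _), det_fderiv_eq_det_jacobian (hd y hy),
    gram_transition g he he' hy.1 (hAe' hy.2), Matrix.det_mul, Matrix.det_mul,
    Matrix.det_transpose, mul_right_comm, Real.sqrt_mul (mul_self_nonneg _),
    Real.sqrt_mul_self_eq_abs]

theorem chartMeasure_compl_source (g : Metric m M) (e : OpenPartialHomeomorph M (Coord m)) :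
    chartMeasure g e e.sourceᶜ = 0 := by
  rw [chartMeasure_apply g e e.open_source.measurableSet.compl]
  have : e.target ∩ e.symm ⁻¹' e.sourceᶜ = ∅ := by
    ext y
    simp only [Set.mem_inter_iff, Set.mem_preimage, Set.mem_compl_iff, Set.mem_empty_iff_false,
      iff_false, not_and, not_not]
    exact fun hy => e.map_target hy
  rw [this, Measure.restrict_empty, lintegral_zero_measure]

variable [SecondCountableTopology M] [Nonempty M]

/-- In the domain of any chart the Riemannian measure is `√(det g_ij) dx¹ ⋯ dxᵐ`. -/
theorem riemannianMeasure_restrict_source (g : Metric m M)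
    {e : OpenPartialHomeomorph M (Coord m)} (he : e ∈ atlas (Coord m) M) :
    (riemannianMeasure g).restrict e.source = chartMeasure g e := by
  ext A hA
  set S : ℕ → Set M := fun k => (chartAt (Coord m) (chartCenter m M k)).source with hS
  have hSm : ∀ k, MeasurableSet (S k) := fun k => (chartAt _ _).open_source.measurableSet
  have hD : ∀ k, MeasurableSet (disjointed S k) := fun k => MeasurableSet.disjointed hSm k
  have hAe : MeasurableSet (A ∩ e.source) := hA.inter e.open_source.measurableSet
  have hcover : ⋃ k, disjointed S k = Set.univ := by
    rw [iUnion_disjointed]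
    exact (exists_chart_cover m M).choose_spec
  rw [Measure.restrict_apply hA, riemannianMeasure, Measure.sum_apply _ hAe]
  have h1 : ∀ k, ((chartMeasure g (chartAt (Coord m) (chartCenter m M k))).restrict
      (disjointed S k)) (A ∩ e.source) = chartMeasure g e (A ∩ e.source ∩ disjointed S k) := by
    intro k
    rw [Measure.restrict_apply hAe]
    exact chartMeasure_eq g (chart_mem_atlas _ _) he (hAe.inter (hD k))
      (Set.inter_subset_right.trans (disjointed_subset S k))
      (Set.inter_subset_left.trans Set.inter_subset_right)
  rw [tsum_congr h1, ← measure_iUnion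
    (fun i j hij => (disjoint_disjointed S hij).mono Set.inter_subset_right Set.inter_subset_right)
    (fun k => hAe.inter (hD k)), ← Set.inter_iUnion, hcover, Set.inter_univ]
  exact measure_inter_conull (chartMeasure_compl_source g e)

theorem isLocallyFiniteMeasure_riemannianMeasure (g : Metric m M) :
    IsLocallyFiniteMeasure (riemannianMeasure g) := by
  refine ⟨fun x => ?_⟩
  set e := chartAt (Coord m) x with he
  have hea : e ∈ atlas (Coord m) M := chart_mem_atlas _ x
  obtain ⟨r, hr, hball⟩ := Metric.nhds_basis_closedBall.mem_iff.1
    (e.open_target.mem_nhds (mem_chart_target _ x))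
  have hN : e.source ∩ e ⁻¹' (_root_.Metric.ball (e x) r) ∈ 𝓝 x :=
    inter_mem (e.open_source.mem_nhds (mem_chart_source _ x))
      ((e.continuousAt (mem_chart_source _ x)).preimage_mem_nhds (_root_.Metric.ball_mem_nhds _ hr))
  have hNo : MeasurableSet (e.source ∩ e ⁻¹' (_root_.Metric.ball (e x) r)) :=
    (e.continuousOn.isOpen_inter_preimage e.open_source _root_.Metric.isOpen_ball).measurableSet
  refine ⟨_, hN, ?_⟩
  have h1 : riemannianMeasure g (e.source ∩ e ⁻¹' (_root_.Metric.ball (e x) r))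
      = chartMeasure g e (e.source ∩ e ⁻¹' (_root_.Metric.ball (e x) r)) := by
    rw [← riemannianMeasure_restrict_source g hea, Measure.restrict_apply hNo]
    congr 1
    rw [Set.inter_assoc, Set.inter_comm _ e.source, ← Set.inter_assoc, Set.inter_self]
  rw [h1, chartMeasure_apply g e hNo]
  have h2 : e.target ∩ e.symm ⁻¹' (e.source ∩ e ⁻¹' (_root_.Metric.ball (e x) r))
      ⊆ _root_.Metric.closedBall (e x) r := by
    rintro y ⟨hy, -, hy2⟩
    rw [Set.mem_preimage, e.right_inv hy] at hy2
    exact _root_.Metric.ball_subset_closedBall hy2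
  refine (lintegral_mono_set h2).trans_lt ?_
  exact (((continuousOn_sqrt_det_gram g hea).mono hball).integrableOn_compact
    (isCompact_closedBall _ _)).lintegral_lt_top

/-- The integral of a function supported in the domain of a chart. -/
theorem integral_riemannianMeasure (g : Metric m M) {e : OpenPartialHomeomorph M (Coord m)}
    (he : e ∈ atlas (Coord m) M) {F : M → ℝ} (hF : Continuous F) (hFe : ∀ x ∉ e.source, F x = 0) :
    ∫ x, F x ∂riemannianMeasure g
      = ∫ y in e.target, √(gram g e y).det * F (e.symm y) := by
  rw [← setIntegral_eq_integral_of_forall_compl_eq_zero hFe, riemannianMeasure_restrict_source g he,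
    chartMeasure, integral_map (aemeasurable_symm e _) hF.aestronglyMeasurable,
    integral_withDensity_eq_integral_toReal_smul₀]
  · simp only [ENNReal.toReal_ofReal (Real.sqrt_nonneg _), smul_eq_mul]
  · exact ((continuousOn_sqrt_det_gram g he).aemeasurable
      e.open_target.measurableSet).ennreal_ofReal
  · exact Eventually.of_forall fun _ => ENNReal.ofReal_lt_top

end RiemannianMeasure

/-! ### The divergence theorem in a chart -/

section DivergenceTheorem

variable {m : ℕ}

theorem integral_pd_eq_zero {f : Coord m → ℝ} (hf : ContDiff ℝ 1 f) (hc : HasCompactSupport f)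
    (i : Fin m) : Integrable (pd i f) ∧ ∫ y, pd i f y = 0 := by
  have hcont : Continuous (pd i f) := (hf.continuous_fderiv (by simp)).clm_apply continuous_const
  have hint : Integrable (pd i f) :=
    hcont.integrable_of_hasCompactSupport (hc.fderiv_apply (𝕜 := ℝ) _)
  refine ⟨hint, ?_⟩
  -- integration by parts against the constant function `1`
  have hint' : Integrable fun y => pd i f y * 1 := by simpa only [mul_one] using hint
  have h := integral_mul_fderiv_eq_neg_fderiv_mul_of_integrable (μ := volume) (f := f)
    (g := fun _ : Coord m => (1 : ℝ)) (v := EuclideanSpace.single i 1) hint'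
    (by simp) (by simpa using hf.continuous.integrable_of_hasCompactSupport hc)
    (fun x _ => hf.differentiable (by simp) x) (fun x _ => differentiableAt_const _)
  simpa [pd, eq_comm] using h

/-- The divergence theorem for a vector field with compact support in an open set. Only the values
of the field on the open set matter: extended by zero, the field is smooth. -/
theorem setIntegral_sum_pd_eq_zero {U K : Set (Coord m)} (hU : IsOpen U) (hK : IsCompact K)
    (hKU : K ⊆ U) {V : Fin m → Coord m → ℝ} (hV : ∀ i, ∀ y ∈ U, ContDiffAt ℝ ∞ (V i) y)
    (h0 : ∀ i, ∀ y ∈ U, y ∉ K → V i y = 0) :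
    IntegrableOn (fun y => ∑ i, pd i (V i) y) U ∧ ∫ y in U, ∑ i, pd i (V i) y = 0 := by
  set W : Fin m → Coord m → ℝ := fun i => U.indicator (V i) with hW
  have hWV : ∀ i, ∀ y ∈ U, W i =ᶠ[𝓝 y] V i := fun i y hy => by
    filter_upwards [hU.mem_nhds hy] with z hz
    exact Set.indicator_of_mem hz _
  have hW0 : ∀ i, ∀ y ∉ K, W i y = 0 := fun i y hy => by
    by_cases hyU : y ∈ U
    · rw [hW]
      simp only [Set.indicator_of_mem hyU, h0 i y hyU hy]
    · exact Set.indicator_of_notMem hyU _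
  have hWK : ∀ i, ∀ y ∉ K, W i =ᶠ[𝓝 y] fun _ => 0 := fun i y hy => by
    filter_upwards [hK.isClosed.isOpen_compl.mem_nhds hy] with z hz
    exact hW0 i z hz
  have hWc : ∀ i, ContDiff ℝ 1 (W i) := fun i => by
    rw [contDiff_iff_contDiffAt]
    intro y
    by_cases hy : y ∈ K
    · exact ((hV i y (hKU hy)).congr_of_eventuallyEq (hWV i y (hKU hy))).of_le (by simp)
    · exact contDiffAt_const.congr_of_eventuallyEq (hWK i y hy)
  have hWs : ∀ i, HasCompactSupport (W i) := fun i => HasCompactSupport.intro hK (hW0 i)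
  have hi := fun i => integral_pd_eq_zero (hWc i) (hWs i) i
  have hcongr : ∀ y ∈ U, ∑ i, pd i (W i) y = ∑ i, pd i (V i) y := fun y hy =>
    Finset.sum_congr rfl fun i _ => ((hWV i y hy).pd i).self_of_nhds
  have hsum : Integrable (fun y => ∑ i, pd i (W i) y) := integrable_finsetSum _ fun i _ => (hi i).1
  refine ⟨hsum.integrableOn.congr_fun hcongr hU.measurableSet, ?_⟩
  rw [← setIntegral_congr_fun hU.measurableSet hcongr,
    setIntegral_eq_integral_of_forall_compl_eq_zero, integral_finsetSum _ fun i _ => (hi i).1]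
  · exact Finset.sum_eq_zero fun i _ => (hi i).2
  · intro y hy
    refine Finset.sum_eq_zero fun i _ => ?_
    rw [((hWK i y fun h => hy (hKU h)).pd i).self_of_nhds, pd_const]

end DivergenceTheorem

section Localized

variable {m : ℕ} {M : Type*} [TopologicalSpace M] [ChartedSpace (Coord m) M]
  [IsManifold (𝓡 m) ∞ M] [MeasurableSpace M] [BorelSpace M] [SecondCountableTopology M]
  [Nonempty M] (g : Metric m M) {u φ : M → ℝ} {e : OpenPartialHomeomorph M (Coord m)}

/-- Green's formula for `φ u ∇ u`, where `φ` is supported in the domain of a chart. -/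
theorem integral_green_localized (hu : ContMDiff (𝓡 m) 𝓘(ℝ, ℝ) ∞ u) (huc : HasCompactSupport u)
    (hφ : ContMDiff (𝓡 m) 𝓘(ℝ, ℝ) ∞ φ) (he : e ∈ atlas (Coord m) M) (hφe : tsupport φ ⊆ e.source) :
    ∫ x, (φ x * (gradInner g u u x + u x * laplacian g u x) + u x * gradInner g φ u x)
      ∂riemannianMeasure g = 0 := by
  have hcu := hu.continuous
  have hcφ := hφ.continuous
  have hc1 := (contMDiff_gradInner g hu hu).continuous
  have hc2 := (contMDiff_gradInner g hφ hu).continuous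
  have hc3 := (contMDiff_laplacian g hu).continuous
  rw [integral_riemannianMeasure g he (by fun_prop)]
  swap
  · intro x hx
    have hx' : x ∉ tsupport φ := fun h => hx (hφe h)
    rw [image_eq_zero_of_notMem_tsupport hx', gradInner_eq_zero_left g hx', zero_mul, mul_zero,
      add_zero]
  set K : Set (Coord m) := e '' (tsupport u ∩ tsupport φ) with hK
  have hKc : IsCompact K := (huc.isCompact.inter_right (isClosed_tsupport φ)).image_of_continuousOn
    (e.continuousOn.mono (Set.inter_subset_right.trans hφe))
  have hKU : K ⊆ e.target := by
    rintro _ ⟨x, hx, rfl⟩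
    exact e.map_source (hφe hx.2)
  have hfs := fun y hy => contDiffAt_comp_symm hu he (y := y) hy
  have hφs := fun y hy => contDiffAt_comp_symm hφ he (y := y) hy
  set V : Fin m → Coord m → ℝ := fun i z => √(gram g e z).det *
    (((φ ∘ e.symm) z * (u ∘ e.symm) z) * grad (gram g e) (u ∘ e.symm) i z) with hV
  have hVs : ∀ i, ∀ y ∈ e.target, ContDiffAt ℝ ∞ (V i) y := fun i y hy =>
    (metricAt_gram g he hy).contDiffAt_sqrt_det.mul (((hφs y hy).mul (hfs y hy)).mul
      ((metricAt_gram g he hy).contDiffAt_grad (hfs y hy) i))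
  have hV0 : ∀ i, ∀ y ∈ e.target, y ∉ K → V i y = 0 := by
    intro i y hy hyK
    have : e.symm y ∉ tsupport u ∩ tsupport φ := fun h => hyK ⟨_, h, e.right_inv hy⟩
    rw [Set.mem_inter_iff, not_and_or] at this
    rcases this with h | h <;> simp [hV, image_eq_zero_of_notMem_tsupport h]
  rw [← (setIntegral_sum_pd_eq_zero e.open_target hKc hKU hVs hV0).2]
  refine setIntegral_congr_fun e.open_target.measurableSet fun y hy => ?_
  have hx := e.map_target hy
  have hG := metricAt_gram g he hy
  simp only [gradInner_eq g hu hu he hx, gradInner_eq g hφ hu he hx, laplacian_eq g hu he hx,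
    e.right_inv hy]
  rw [hV, hG.sum_pd_sqrt_det_mul ((hφs y hy).mul (hfs y hy)) (hG.contDiffAt_grad (hfs y hy)),
    hG.divergence_grad (hfs y hy)]
  simp only [pd_mul (hφs y hy).differentiableAt_top (hfs y hy).differentiableAt_top, add_mul,
    Finset.sum_add_distrib, gradProd_eq_sum_grad, mul_assoc]
  simp only [← Finset.mul_sum, mul_left_comm _ ((u ∘ e.symm) y)]
  simp only [Function.comp_apply]
  ring

/-- Bochner's inequality integrated against a weight `φ` supported in the domain of a chart. -/
theorem integral_bochner_localized {K : ℝ} (hRic : RicciBoundedBelow g (-K ^ 2))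
    (hu : ContMDiff (𝓡 m) 𝓘(ℝ, ℝ) ∞ u) (huc : HasCompactSupport u)
    (hφ : ContMDiff (𝓡 m) 𝓘(ℝ, ℝ) ∞ φ) (hφ0 : ∀ x, 0 ≤ φ x) (he : e ∈ atlas (Coord m) M)
    (hφe : tsupport φ ⊆ e.source) :
    ∫ x, (φ x * (hessNormSq g u x - laplacian g u x ^ 2 - K ^ 2 * gradInner g u u x)
      + (1 / 2 * gradInner g φ (gradInner g u u) x - laplacian g u x * gradInner g φ u x))
      ∂riemannianMeasure g ≤ 0 := by
  have huu := contMDiff_gradInner g hu hu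
  have hcφ := hφ.continuous
  have hc1 := huu.continuous
  have hc2 := (contMDiff_gradInner g hφ hu).continuous
  have hc3 := (contMDiff_laplacian g hu).continuous
  have hc4 := (contMDiff_hessNormSq g hu).continuous
  have hc5 := (contMDiff_gradInner g hφ huu).continuous
  set F : M → ℝ := fun x =>
    φ x * (hessNormSq g u x - laplacian g u x ^ 2 - K ^ 2 * gradInner g u u x)
      + (1 / 2 * gradInner g φ (gradInner g u u) x - laplacian g u x * gradInner g φ u x) with hF
  have hFc : Continuous F := by fun_prop
  have hFφ : ∀ x ∉ tsupport φ, F x = 0 := by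
    intro x hx
    simp [hF, image_eq_zero_of_notMem_tsupport hx, gradInner_eq_zero_left g hx]
  have hFu : ∀ x ∉ tsupport u, F x = 0 := by
    intro x hx
    have hx2 : gradInner g φ (gradInner g u u) x = 0 := by
      have : gradInner g u u =ᶠ[𝓝 x] fun _ => 0 := by
        filter_upwards [(isClosed_tsupport u).isOpen_compl.mem_nhds hx] with z hz
        exact gradInner_eq_zero_left g hz
      rw [gradInner_congr g (EventuallyEq.refl _ φ) this]
      exact gradProd_const_right 0
    simp [hF, gradInner_eq_zero_left g hx, laplacian_eq_zero g hx, hessNormSq_eq_zero g hx, hx2]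
  rw [integral_riemannianMeasure g he hFc fun x hx => hFφ x fun h => hx (hφe h)]
  set S : Set (Coord m) := e '' (tsupport u ∩ tsupport φ) with hS
  have hSc : IsCompact S := (huc.isCompact.inter_right (isClosed_tsupport φ)).image_of_continuousOn
    (e.continuousOn.mono (Set.inter_subset_right.trans hφe))
  have hSU : S ⊆ e.target := by
    rintro _ ⟨x, hx, rfl⟩
    exact e.map_source (hφe hx.2)
  have hfs := fun y hy => contDiffAt_comp_symm hu he (y := y) hy
  have hφs := fun y hy => contDiffAt_comp_symm hφ he (y := y) hy
  have hnot : ∀ y ∈ e.target, y ∉ S → e.symm y ∉ tsupport u ∨ e.symm y ∉ tsupport φ := by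
    intro y hy hyS
    have : e.symm y ∉ tsupport u ∩ tsupport φ := fun h => hyS ⟨_, h, e.right_inv hy⟩
    rwa [Set.mem_inter_iff, not_and_or] at this
  set V : Fin m → Coord m → ℝ := fun i z => √(gram g e z).det * ((φ ∘ e.symm) z *
    bochnerField (christoffel (gram g e)) (grad (gram g e) (u ∘ e.symm)) i z) with hV
  have hVs : ∀ i, ∀ y ∈ e.target, ContDiffAt ℝ ∞ (V i) y := fun i y hy =>
    (metricAt_gram g he hy).contDiffAt_sqrt_det.mul ((hφs y hy).mul
      ((metricAt_gram g he hy).contDiffAt_bochnerField (hfs y hy) i))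
  have hV0 : ∀ i, ∀ y ∈ e.target, y ∉ S → V i y = 0 := by
    intro i y hy hyS
    rcases hnot y hy hyS with h | h
    · have h0 : u ∘ e.symm =ᶠ[𝓝 y] fun _ => 0 :=
        (e.continuousAt_symm hy).eventually (eventuallyEq_zero_of_notMem_tsupport h)
      have hg0 : ∀ k, grad (gram g e) (u ∘ e.symm) k y = 0 := fun k =>
        Finset.sum_eq_zero fun l _ => by rw [(h0.pd l).self_of_nhds, pd_const, mul_zero]
      simp [hV, bochnerField, hg0]
    · simp [hV, image_eq_zero_of_notMem_tsupport h]
  obtain ⟨hint, hzero⟩ := setIntegral_sum_pd_eq_zero e.open_target hSc hSU hVs hV0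
  rw [← hzero]
  refine setIntegral_mono_on ?_ hint e.open_target.measurableSet fun y hy => ?_
  · have hcont : ContinuousOn (fun y => √(gram g e y).det * F (e.symm y)) e.target :=
      (continuousOn_sqrt_det_gram g he).mul (hFc.comp_continuousOn e.continuousOn_symm)
    refine ((hcont.mono hSU).integrableOn_compact hSc).of_forall_sdiff_eq_zero
      e.open_target.measurableSet fun y hy => ?_
    rcases hnot y hy.1 hy.2 with h | h
    · rw [hFu _ h, mul_zero]
    · rw [hFφ _ h, mul_zero]
  · have hx := e.map_target hy
    have hG := metricAt_gram g he hy
    -- the curvature bound is used in the chart `e`, for the tangent vector `∇ u`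
    have hR := hRic e he (e.symm y) hx fun k => grad (gram g e) (u ∘ e.symm) k y
    rw [e.right_inv hy, hG.sum_sum_mul_grad, gradSq_eq_gradProd] at hR
    have hgg : gradInner g φ (gradInner g u u) (e.symm y) = gradProd (gram g e) (φ ∘ e.symm)
        (gradProd (gram g e) (u ∘ e.symm) (u ∘ e.symm)) y := by
      rw [gradInner_eq g hφ huu he hx, e.right_inv hy]
      refine gradProd_congr (EventuallyEq.refl _ _) ?_
      filter_upwards [e.open_target.mem_nhds hy] with z hz
      rw [Function.comp_apply, gradInner_eq g hu hu he (e.map_target hz), e.right_inv hz]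
    rw [hV, hG.sum_pd_sqrt_det_mul (hφs y hy) (hG.contDiffAt_bochnerField (hfs y hy)),
      hG.divergence_bochnerField (hfs y hy), hG.sum_pd_mul_bochnerField (hfs y hy)]
    simp only [hF, hgg, gradInner_eq g hu hu he hx, gradInner_eq g hφ hu he hx,
      laplacian_eq g hu he hx, hessNormSq_eq g hu he hx, e.right_inv hy]
    refine mul_le_mul_of_nonneg_left ?_ (Real.sqrt_nonneg _)
    have h0 : 0 ≤ (φ ∘ e.symm) y := hφ0 _
    have h1 := mul_le_mul_of_nonneg_left hR h0
    simp only [Function.comp_apply] at h1 ⊢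
    linarith

end Localized

/-! ### The estimate -/

section Global

/-- Finitely many bump functions, each supported in the domain of one chart, that add up to `1`
near a given compact set. -/
theorem exists_finite_partition (m : ℕ) {M : Type*} [TopologicalSpace M] [T2Space M]
    [ChartedSpace (Coord m) M] [IsManifold (𝓡 m) ∞ M] [SecondCountableTopology M] {K : Set M}
    (hK : IsCompact K) :
    ∃ (s : Finset M) (φ : M → M → ℝ),
      (∀ c, ContMDiff (𝓡 m) 𝓘(ℝ, ℝ) ∞ (φ c)) ∧ (∀ c x, 0 ≤ φ c x) ∧
      (∀ c, tsupport (φ c) ⊆ (chartAt (Coord m) c).source) ∧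
      ∀ x ∈ K, (fun z => ∑ c ∈ s, φ c z) =ᶠ[𝓝 x] fun _ => 1 := by
  have : LocallyCompactSpace M := ChartedSpace.locallyCompactSpace (Coord m) M
  obtain ⟨ρ, hρ⟩ := SmoothPartitionOfUnity.exists_isSubordinate_chartAt_source (𝓡 m) M
  have hlf : LocallyFinite fun c => tsupport (ρ c) := ρ.locallyFinite.closure
  have hfin := hlf.finite_nonempty_inter_compact hK
  refine ⟨hfin.toFinset, fun c => ρ c, fun c => (ρ c).contMDiff, fun c x => ρ.nonneg c x, hρ,
    fun x hx => ?_⟩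
  -- the supports that do not meet `K` have a closed union, so `x` has a neighbourhood missing it
  have hlf' : LocallyFinite fun c : {c // c ∉ hfin.toFinset} => tsupport (ρ c) :=
    hlf.comp_injective Subtype.val_injective
  have hcl : IsClosed (⋃ c : {c // c ∉ hfin.toFinset}, tsupport (ρ c)) :=
    hlf'.isClosed_iUnion fun c => isClosed_tsupport _
  have hxn : x ∉ ⋃ c : {c // c ∉ hfin.toFinset}, tsupport (ρ c) := by
    rw [Set.mem_iUnion]
    rintro ⟨⟨c, hc⟩, hxc⟩
    exact hc (hfin.mem_toFinset.2 ⟨x, hxc, hx⟩)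
  filter_upwards [hcl.isOpen_compl.mem_nhds hxn] with z hz
  rw [← ρ.sum_eq_one (Set.mem_univ z), finsum_eq_sum_of_support_subset]
  intro c hc
  by_contra hcs
  exact hz (Set.mem_iUnion.2 ⟨⟨c, hcs⟩, subset_tsupport _ hc⟩)

variable {m : ℕ} {M : Type*} [TopologicalSpace M] [T2Space M] [ChartedSpace (Coord m) M]
  [IsManifold (𝓡 m) ∞ M] [SecondCountableTopology M]
  [MeasurableSpace M] [BorelSpace M] [Nonempty M] (g : Metric m M) {u : M → ℝ}

theorem _root_.Continuous.integrable_riemannianMeasure {F : M → ℝ} (hF : Continuous F)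
    (hu : HasCompactSupport u) (h0 : ∀ x ∉ tsupport u, F x = 0) :
    Integrable F (riemannianMeasure g) := by
  have := isLocallyFiniteMeasure_riemannianMeasure g
  exact hF.integrable_of_hasCompactSupport (HasCompactSupport.intro hu.isCompact h0)

/-- **Green's formula**: the integral of `|∇ u|²` is the integral of `- u Δ u`. -/
theorem integral_gradInner_self (hu : ContMDiff (𝓡 m) 𝓘(ℝ, ℝ) ∞ u) (huc : HasCompactSupport u) :
    ∫ x, (gradInner g u u x + u x * laplacian g u x) ∂riemannianMeasure g = 0 := by
  obtain ⟨s, φ, hφ, -, hφs, hone⟩ := exists_finite_partition m huc.isCompact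
  have hcu := hu.continuous
  have hc1 := (contMDiff_gradInner g hu hu).continuous
  have hc3 := (contMDiff_laplacian g hu).continuous
  have hsum : ∀ x, gradInner g u u x + u x * laplacian g u x
      = ∑ c ∈ s, (φ c x * (gradInner g u u x + u x * laplacian g u x)
        + u x * gradInner g (φ c) u x) := by
    intro x
    by_cases hx : x ∈ tsupport u
    · have hx1 : ∑ c ∈ s, φ c x = 1 := (hone x hx).self_of_nhds
      rw [Finset.sum_add_distrib, ← Finset.sum_mul, ← Finset.mul_sum,
        ← gradInner_sum_left g s hφ, hx1,
        gradInner_congr g (hone x hx) (EventuallyEq.refl _ u)]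
      have : gradInner g (fun _ => 1) u x = 0 := gradProd_const_left 1
      rw [this]
      ring
    · simp [gradInner_eq_zero_right g hx, image_eq_zero_of_notMem_tsupport hx]
  rw [funext hsum, integral_finsetSum]
  · exact Finset.sum_eq_zero fun c _ =>
      integral_green_localized g hu huc (hφ c) (chart_mem_atlas _ c) (hφs c)
  · intro c _
    have hcφ := (hφ c).continuous
    have hc2 := (contMDiff_gradInner g (hφ c) hu).continuous
    refine Continuous.integrable_riemannianMeasure g (by fun_prop) huc fun x hx => ?_
    simp [gradInner_eq_zero_right g hx, image_eq_zero_of_notMem_tsupport hx]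

/-- The integrated Bochner inequality. -/
theorem integral_bochner {K : ℝ} (hRic : RicciBoundedBelow g (-K ^ 2))
    (hu : ContMDiff (𝓡 m) 𝓘(ℝ, ℝ) ∞ u) (huc : HasCompactSupport u) :
    ∫ x, (hessNormSq g u x - laplacian g u x ^ 2 - K ^ 2 * gradInner g u u x)
      ∂riemannianMeasure g ≤ 0 := by
  obtain ⟨s, φ, hφ, hφ0, hφs, hone⟩ := exists_finite_partition m huc.isCompact
  have huu := contMDiff_gradInner g hu hu
  have hc1 := huu.continuous
  have hc3 := (contMDiff_laplacian g hu).continuous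
  have hc4 := (contMDiff_hessNormSq g hu).continuous
  have hzero : ∀ x ∉ tsupport u, ∀ a, gradInner g a (gradInner g u u) x = 0 := by
    intro x hx a
    have : gradInner g u u =ᶠ[𝓝 x] fun _ => 0 := by
      filter_upwards [(isClosed_tsupport u).isOpen_compl.mem_nhds hx] with z hz
      exact gradInner_eq_zero_left g hz
    rw [gradInner_congr g (EventuallyEq.refl _ a) this]
    exact gradProd_const_right 0
  have hsum : ∀ x, hessNormSq g u x - laplacian g u x ^ 2 - K ^ 2 * gradInner g u u x
      = ∑ c ∈ s, (φ c x * (hessNormSq g u x - laplacian g u x ^ 2 - K ^ 2 * gradInner g u u x)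
        + (1 / 2 * gradInner g (φ c) (gradInner g u u) x
          - laplacian g u x * gradInner g (φ c) u x)) := by
    intro x
    by_cases hx : x ∈ tsupport u
    · have hx1 : ∑ c ∈ s, φ c x = 1 := (hone x hx).self_of_nhds
      rw [Finset.sum_add_distrib, Finset.sum_sub_distrib, ← Finset.sum_mul, ← Finset.mul_sum,
        ← Finset.mul_sum, ← gradInner_sum_left g s hφ, ← gradInner_sum_left g s hφ,
        hx1, gradInner_congr g (hone x hx) (EventuallyEq.refl _ u),
        gradInner_congr g (hone x hx) (EventuallyEq.refl _ (gradInner g u u))]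
      have h1 : ∀ b, gradInner g (fun _ => 1) b x = 0 := fun b => gradProd_const_left 1
      rw [h1, h1]
      ring
    · simp [gradInner_eq_zero_right g hx, laplacian_eq_zero g hx, hessNormSq_eq_zero g hx,
        hzero x hx]
  rw [funext hsum, integral_finsetSum]
  · exact Finset.sum_nonpos fun c _ => integral_bochner_localized g hRic hu huc (hφ c) (hφ0 c)
      (chart_mem_atlas _ c) (hφs c)
  · intro c _
    have hcφ := (hφ c).continuous
    have hc2 := (contMDiff_gradInner g (hφ c) hu).continuous
    have hc5 := (contMDiff_gradInner g (hφ c) huu).continuous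
    refine Continuous.integrable_riemannianMeasure g (by fun_prop) huc fun x hx => ?_
    simp [gradInner_eq_zero_right g hx, laplacian_eq_zero g hx, hessNormSq_eq_zero g hx,
      hzero x hx]

theorem eLpNorm_two_riemannianMeasure {F : M → ℝ} (hF : Continuous F)
    (hu : HasCompactSupport u) (h0 : ∀ x ∉ tsupport u, F x = 0) :
    eLpNorm F 2 (riemannianMeasure g)
      = ENNReal.ofReal √(∫ x, F x ^ 2 ∂riemannianMeasure g) := by
  have := isLocallyFiniteMeasure_riemannianMeasure g
  have hmem : MemLp F 2 (riemannianMeasure g) :=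
    hF.memLp_of_hasCompactSupport (HasCompactSupport.intro hu.isCompact h0)
  rw [hmem.eLpNorm_eq_integral_rpow_norm (by simp) (by simp), Real.sqrt_eq_rpow]
  simp

/-- The `W^{2,2}` estimate on one manifold, with the constant `3 + K`. -/
theorem sobolev_estimate {K : ℝ} (hK : 0 ≤ K) (hRic : RicciBoundedBelow g (-K ^ 2))
    (hu : ContMDiff (𝓡 m) 𝓘(ℝ, ℝ) ∞ u) (huc : HasCompactSupport u) :
    eLpNorm u 2 (riemannianMeasure g) + eLpNorm (gradNorm g u) 2 (riemannianMeasure g)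
        + eLpNorm (hessNorm g u) 2 (riemannianMeasure g)
      ≤ ENNReal.ofReal (3 + K) * (eLpNorm u 2 (riemannianMeasure g)
        + eLpNorm (laplacian g u) 2 (riemannianMeasure g)) := by
  have hcu := hu.continuous
  have hc1 := (contMDiff_gradInner g hu hu).continuous
  have hc3 := (contMDiff_laplacian g hu).continuous
  have hc4 := (contMDiff_hessNormSq g hu).continuous
  have z1 : ∀ x ∉ tsupport u, gradInner g u u x = 0 := fun x hx => gradInner_eq_zero_right g hx
  have z3 : ∀ x ∉ tsupport u, laplacian g u x = 0 := fun x hx => laplacian_eq_zero g hx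
  have z4 : ∀ x ∉ tsupport u, hessNormSq g u x = 0 := fun x hx => hessNormSq_eq_zero g hx
  have zu : ∀ x ∉ tsupport u, u x = 0 := fun x hx => image_eq_zero_of_notMem_tsupport hx
  have eg : gradNorm g u = fun x => √(gradInner g u u x) := funext (gradNorm_eq_sqrt g u)
  have eh : hessNorm g u = fun x => √(hessNormSq g u x) := funext (hessNorm_eq_sqrt g u)
  rw [eg, eh, eLpNorm_two_riemannianMeasure g hcu huc zu,
    eLpNorm_two_riemannianMeasure g hc3 huc z3,
    eLpNorm_two_riemannianMeasure g hc1.sqrt huc fun x hx => by rw [z1 x hx, Real.sqrt_zero],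
    eLpNorm_two_riemannianMeasure g hc4.sqrt huc fun x hx => by rw [z4 x hx, Real.sqrt_zero]]
  simp only [Real.sq_sqrt (gradInner_self_nonneg g u _), Real.sq_sqrt (hessNormSq_nonneg g u _)]
  set μ := riemannianMeasure g with hμ
  have i1 : Integrable (gradInner g u u) μ := hc1.integrable_riemannianMeasure g huc z1
  have i4 : Integrable (hessNormSq g u) μ := hc4.integrable_riemannianMeasure g huc z4
  have iu : Integrable (fun x => u x ^ 2) μ :=
    (hcu.pow 2).integrable_riemannianMeasure g huc fun x hx => by simp [zu x hx]
  have il : Integrable (fun x => laplacian g u x ^ 2) μ :=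
    (hc3.pow 2).integrable_riemannianMeasure g huc fun x hx => by simp [z3 x hx]
  have iul : Integrable (fun x => u x * laplacian g u x) μ :=
    (hcu.mul hc3).integrable_riemannianMeasure g huc fun x hx => by simp [z3 x hx]
  set A := ∫ x, u x ^ 2 ∂μ with hA
  set B := ∫ x, laplacian g u x ^ 2 ∂μ with hB
  set C := ∫ x, gradInner g u u x ∂μ with hC
  set D := ∫ x, hessNormSq g u x ∂μ with hD
  have hA0 : 0 ≤ A := integral_nonneg fun x => sq_nonneg _
  have hB0 : 0 ≤ B := integral_nonneg fun x => sq_nonneg _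
  have hCle : C ≤ A + B := by
    have h1 : C + ∫ x, u x * laplacian g u x ∂μ = 0 := by
      rw [← integral_add i1 iul]
      exact integral_gradInner_self g hu huc
    have h2 : -(A + B) ≤ ∫ x, u x * laplacian g u x ∂μ := by
      rw [← integral_add iu il, ← integral_neg]
      refine integral_mono (iu.add il).neg iul fun x => ?_
      simp only
      nlinarith [sq_nonneg (u x + laplacian g u x), sq_nonneg (u x), sq_nonneg (laplacian g u x)]
    linarith
  have hDle : D ≤ B + K ^ 2 * C := by
    have h1 : D - B - K ^ 2 * C ≤ 0 := by
      have i5 : Integrable (fun x => hessNormSq g u x - laplacian g u x ^ 2) μ := i4.sub il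
      rw [hD, hB, hC, ← integral_const_mul, ← integral_sub i4 il,
        ← integral_sub i5 (i1.const_mul _)]
      exact integral_bochner g hRic hu huc
    linarith
  have hs : 0 ≤ √A + √B := by positivity
  have hAB : A + B ≤ (√A + √B) ^ 2 := by
    nlinarith [Real.sq_sqrt hA0, Real.sq_sqrt hB0, Real.sqrt_nonneg A, Real.sqrt_nonneg B]
  have hCs : √C ≤ √A + √B := Real.sqrt_le_iff.2 ⟨hs, hCle.trans hAB⟩
  have hDs : √D ≤ (1 + K) * (√A + √B) := by
    refine Real.sqrt_le_iff.2 ⟨by positivity, ?_⟩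
    have h1 : K ^ 2 * C ≤ K ^ 2 * (√A + √B) ^ 2 :=
      mul_le_mul_of_nonneg_left (hCle.trans hAB) (sq_nonneg K)
    nlinarith [mul_nonneg hK (sq_nonneg (√A + √B))]
  rw [← ENNReal.ofReal_add (Real.sqrt_nonneg _) (Real.sqrt_nonneg _),
    ← ENNReal.ofReal_add (by positivity) (Real.sqrt_nonneg _),
    ← ENNReal.ofReal_add (Real.sqrt_nonneg _) (Real.sqrt_nonneg _),
    ← ENNReal.ofReal_mul (by positivity)]
  refine ENNReal.ofReal_le_ofReal ?_
  nlinarith [Real.sqrt_nonneg B]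

end Global

end RiemL2

end

theorem mainTheorem7 (K : ℝ) (hK : 0 ≤ K) (ε : ℝ) (hε : 0 < ε) :
    ∃ C : ℝ, 0 < C ∧
      ∀ (m : ℕ), 2 ≤ m →
      ∀ (M : Type*) [TopologicalSpace M] [T2Space M] [SecondCountableTopology M]
        [ConnectedSpace M] [MeasurableSpace M] [BorelSpace M]
        [ChartedSpace (RiemL2.Coord m) M] [IsManifold (𝓡 m) ∞ M]
        (g : RiemL2.Metric m M),
        RiemL2.RicciBoundedBelow g (-K ^ 2) →
        ∀ u : M → ℝ, ContMDiff (𝓡 m) 𝓘(ℝ, ℝ) ∞ u → HasCompactSupport u →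
          eLpNorm u 2 (RiemL2.riemannianMeasure g)
              + eLpNorm (RiemL2.gradNorm g u) 2 (RiemL2.riemannianMeasure g)
              + eLpNorm (RiemL2.hessNorm g u) 2 (RiemL2.riemannianMeasure g)
            ≤ ENNReal.ofReal C *
              (eLpNorm u 2 (RiemL2.riemannianMeasure g)
                + eLpNorm (RiemL2.laplacian g u) 2 (RiemL2.riemannianMeasure g)) := by
  refine ⟨3 + K, by linarith, ?_⟩
  intro m _ M _ _ _ _ _ _ _ _ g hRic u hu huc
  exact RiemL2.sobolev_estimate g hK hRic hu huc
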